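/- Let $W$ be a standard Brownian motion, $\rho,\sigma,\tau>0$, $t_i=i\tau$, and let $x_{i+1}=a_ix_i$ with $a_i=1+\rho\,e^{\sigma W(t_i)-\frac12\sigma^2t_i}$ and deterministic initial value $x_{\rm in}>0$ at $i=0$. Write $\lambda(\rho,\beta)=\lim_{n\to\infty}\frac1n\log\mathbb E[x_n]$, the limit being taken with $\beta=\frac12\sigma^2\tau n^2>0$ held fixed ($\sigma,\tau$ may depend on $n$). For $a\ge\log\rho$ put $$F(a;\rho)=\int_{\log\rho}^a\frac{dx}{\sqrt{\log\frac{1+e^a}{1+e^x}}},\qquad \Lambda_{\rho,\beta}(a)=\log(1+e^a)-\frac1{\sqrt\beta}\int_{\log\rho}^a\sqrt{\log\frac{1+e^a}{1+e^x}}\,dx,$$ and call $a\ge\log\rho$ an optimal $h(1)$ if $\Lambda_{\rho,\beta}$ attains its supremum over $[\log\rho,\infty)$ at $a$. Let $H(x)=2xe^{-x^2}\int_0^xe^{t^2}dt$ for $x\ge0$. A phase is a connected open subset of the parameter space $\{(\rho,\beta):\rho,\beta>0\}$ that is maximal for the condition that $\lambda$ is (jointly real-)analytic on it. A phase transition of order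 $j$ occurs at a point of the parameter space lying on the boundary of a phase if at least one $j$-th order partial derivative of $\lambda$ is discontinuous there (or fails to exist there), while all lower-order partial derivatives are continuous there. **Proposition.** The limit $\lambda(\rho,\beta)$ exists for all $\rho,\beta>0$ and does not depend on $x_{\rm in}$ nor on the choice of $\sigma,\tau$ for given $\beta$. The function $H$ attains its maximum over $[0,\infty)$ at some $x_0>0$, with $|H(x_0)-1.285|<0.0005$. Put $\overline\rho_c=H(x_0)\in(0,\infty)$. Then: 1. for every $\rho>\overline\rho_c$, the function $a\mapsto F(a;\rho)$ is strictly increasing on $[\log\rho,\infty)$; 2. for every $\rho>\overline\rho_c$ and $\beta>0$ there is exactly one optimal $h(1)=a$; it satisfies $F(a;\rho)=2\sqrt\beta$ and $\lambda(\rho,\beta)=\Lambda_{\rho,\beta}(a)$; 3. $\lambda$ is real-analytic, jointly in $(\rho,\beta)$, on $\{\rho>\overline\rho_c,\ \beta>0\}$; 4. there is no phase transition of any order at any $(\rho,\beta)$ with $\rho>\overline\rho_c$, $\beta>0$. -/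

import Mathlib

open MeasureTheory ProbabilityTheory Filter Topology Set
open scoped NNReal

noncomputable section

namespace RandomGrowth

/-! ### The random multiplicative process and its Lyapunov exponent -/

/-- The process `x_{i+1} = a_i x_i`, `x_0 = y`, with
`a_i = 1 + ρ exp (σ W(t_i) - σ² t_i / 2)` and `t_i = i τ`. -/
def process {Ω : Type*} (W : ℝ≥0 → Ω → ℝ) (ρ σ : ℝ) (τ : ℝ≥0) (y : ℝ) : ℕ → Ω → ℝ
  | 0, _ => y
  | i + 1, ω =>
      (1 + ρ * Real.exp (σ * W (i * τ) ω - σ ^ 2 / 2 * ((i * τ : ℝ≥0) : ℝ)))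
        * process W ρ σ τ y i ω

/-- `(1/n) log E[x_n]` converges to `L` as `n → ∞` at fixed `β = σ² τ n² / 2`. The parameters
`σ`, `τ` may vary with `n` in any way that keeps `β` fixed, and the initial value `y > 0` is
arbitrary. -/
def HasLyapunovExponent {Ω : Type*} [MeasurableSpace Ω] (W : ℝ≥0 → Ω → ℝ) (P : Measure Ω)
    (ρ β L : ℝ) : Prop :=
  ∀ (y : ℝ) (σ : ℕ → ℝ) (τ : ℕ → ℝ≥0), 0 < y → (∀ n, 0 < σ n) → (∀ n, 0 < τ n) →
    (∀ n : ℕ, 1 ≤ n → 1 / 2 * σ n ^ 2 * (τ n : ℝ) * (n : ℝ) ^ 2 = β) →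
    Tendsto
      (fun n : ℕ => 1 / (n : ℝ) * Real.log (∫ ω, process W ρ (σ n) (τ n) y n ω ∂P))
      atTop (𝓝 L)

/-! ### The reduced variational problem -/

/-- `F(a; ρ) = ∫_{log ρ}^a dx / √(log ((1 + e^a) / (1 + e^x)))`. -/
def slopeIntegral (a ρ : ℝ) : ℝ :=
  ∫ x in (Real.log ρ)..a, 1 / √(Real.log ((1 + Real.exp a) / (1 + Real.exp x)))

/-- The functional `Λ` as a function of the value `a = h(1)`. -/
def reducedFunctional (ρ β a : ℝ) : ℝ :=
  Real.log (1 + Real.exp a) - 1 / √β *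
    ∫ x in (Real.log ρ)..a, √(Real.log ((1 + Real.exp a) / (1 + Real.exp x)))

/-- `a` is an optimal value of `h(1)`: the supremum of `Λ` over `[log ρ, ∞)` is realized at `a`. -/
def IsOptimalEndpoint (ρ β a : ℝ) : Prop :=
  a ∈ Ici (Real.log ρ) ∧ IsMaxOn (reducedFunctional ρ β) (Ici (Real.log ρ)) a

/-- `H(x) = 2 x e^{-x²} ∫_0^x e^{t²} dt`. -/
def dawsonProduct (x : ℝ) : ℝ :=
  2 * x * Real.exp (-x ^ 2) * ∫ t in (0 : ℝ)..x, Real.exp (t ^ 2)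

/-! ### Phases and phase transitions -/

/-- The parameter space of pairs `(ρ, β)`. -/
def paramSpace : Set (ℝ × ℝ) := {p | 0 < p.1 ∧ 0 < p.2}

/-- The two coordinate directions `∂/∂ρ` and `∂/∂β`. -/
def coordDir (i : Fin 2) : ℝ × ℝ := if i = 0 then (1, 0) else (0, 1)

/-- The iterated partial derivative of `f` along a list of coordinates; meaningful on
`iterPartialDomain`. -/
def iterPartial (f : ℝ × ℝ → ℝ) : List (Fin 2) → ℝ × ℝ → ℝ
  | [] => f
  | i :: w => fun p => lineDeriv ℝ (iterPartial f w) p (coordDir i)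

/-- The set of parameters at which the iterated partial derivative of `f` exists. -/
def iterPartialDomain (f : ℝ × ℝ → ℝ) : List (Fin 2) → Set (ℝ × ℝ)
  | [] => paramSpace
  | i :: w => {p | (∀ᶠ t : ℝ in 𝓝 0, p + t • coordDir i ∈ iterPartialDomain f w) ∧
      LineDifferentiableAt ℝ (iterPartial f w) p (coordDir i)}

/-- The partial derivative along `w` exists at `p` and, as a function on the set where it exists,
is continuous at `p`. -/
def PartialContinuousAt (f : ℝ × ℝ → ℝ) (w : List (Fin 2)) (p : ℝ × ℝ) : Prop :=
  p ∈ iterPartialDomain f w ∧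
    ContinuousWithinAt (iterPartial f w) (iterPartialDomain f w) p

/-- A phase: a connected region of the parameter space, maximal for the condition that `f` is
analytic on it. -/
def IsPhase (f : ℝ × ℝ → ℝ) (R : Set (ℝ × ℝ)) : Prop :=
  Maximal (fun S : Set (ℝ × ℝ) =>
    S ⊆ paramSpace ∧ IsOpen S ∧ IsConnected S ∧ AnalyticOnNhd ℝ f S) R

/-- A phase transition of order `j` at `p`: `p` is a boundary point of a phase, some partial
derivative of order `j` is discontinuous at `p` (or does not exist there), and all partial
derivatives of lower order are continuous at `p`. -/
def IsPhaseTransition (f : ℝ × ℝ → ℝ) (j : ℕ) (p : ℝ × ℝ) : Prop :=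
  p ∈ paramSpace ∧ (∃ R, IsPhase f R ∧ p ∈ frontier R) ∧
    (∃ w : List (Fin 2), w.length = j ∧ ¬ PartialContinuousAt f w p) ∧
    ∀ w : List (Fin 2), w.length < j → PartialContinuousAt f w p

end RandomGrowth

end

/-! Expanding the product turns E[x_n] into a sum over subsets S of {0,…,n-1}, weighted by Gaussian
exponential moments. The covariance sum of min(i,j) over S equals the sum of T(k)², where T(k)
counts the elements of S above k (`integral_process_eq`). Completing the square bounds each T(k)²
below by a function affine in T(k), whose slope is an increment of a path h. Summed over S, the
resulting exponentials factorize into the exponential of an action. So every path bounds E[x_n]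
below up to a constant, while exp(O(√n log n)) paths of blockwise constant slope suffice for an
upper bound (`partitionSum_le`). The AM-GM inequality bounds the action by n Λ(h(n))
(`pathAction_le`), with bounded loss along a discretized extremal when F(a) = 2√β
(`exists_le_pathAction`). Hence λ = max Λ for all ρ, β > 0.

The substitutions 1+e^a = (1+ρ)e^{s²} and 1+e^x = (1+ρ)e^{s²(1-u²)} remove the singularity of F,
which becomes 2s times the integral of a smooth density. Its s-derivative is at least 2(1+ρ)/ρ · (1
- H(s)/ρ), which is positive for every s ≥ 0 once ρ > max H (`scaledSlope_deriv_pos`). In the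
variable s, Λ has derivative (s/√β)(2√β - F), so a maximizer solves F = 2√β. Monotonicity makes it
unique, and the implicit function theorem makes it, and hence λ, analytic. -/

namespace RandomGrowth

/-! ### The expectation as a sum over subsets -/

/-- The number of elements of `S` above `k`. -/
def tailCount (S : Finset ℕ) (k : ℕ) : ℕ := (S.filter (k < ·)).card

/-- The value of `E[x_n]` for `x_0 = 1`. -/
noncomputable def partitionSum (n : ℕ) (ρ β : ℝ) : ℝ :=
  ∑ S ∈ (Finset.range n).powerset, ρ ^ S.card *
    Real.exp (β / (n : ℝ) ^ 2 *
      (∑ k ∈ Finset.range n, (tailCount S k : ℝ) ^ 2 - ∑ i ∈ S, (i : ℝ)))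

lemma process_eq_prod {Ω : Type*} (W : ℝ≥0 → Ω → ℝ) (ρ σ : ℝ) (τ : ℝ≥0) (y : ℝ) (n : ℕ) (ω : Ω) :
    process W ρ σ τ y n ω = y * ∏ i ∈ Finset.range n,
      (1 + ρ * Real.exp (σ * W (i * τ) ω - σ ^ 2 / 2 * ((i * τ : ℝ≥0) : ℝ))) := by
  induction n with
  | zero => simp [process]
  | succ n ih => rw [process, ih, Finset.prod_range_succ]; ring

/-- min(i,j) counts the k below both i and j; exchanging the sums produces a square for each k. -/
lemma sum_min_eq_sum_tailCount_sq {n : ℕ} {S : Finset ℕ} (hS : S ⊆ Finset.range n) :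
    ∑ i ∈ S, ∑ j ∈ S, (min i j : ℝ) = ∑ k ∈ Finset.range n, (tailCount S k : ℝ) ^ 2 := by
  have h1 : ∀ i ∈ S, ∀ j ∈ S, (min i j : ℝ)
      = ∑ k ∈ Finset.range n, (if k < i then (1 : ℝ) else 0) * (if k < j then 1 else 0) := by
    intro i hi j hj
    have hi' := Finset.mem_range.1 (hS hi)
    simp only [← ite_and, mul_ite, mul_one, mul_zero]
    rw [Finset.sum_congr rfl (g := fun k => if k < min i j then (1 : ℝ) else 0)]
    · rw [Finset.sum_boole]
      have : (Finset.range n).filter (fun k => k < min i j) = Finset.range (min i j) := by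
        ext k; simp only [Finset.mem_filter, Finset.mem_range]; omega
      rw [this, Finset.card_range]; push_cast; rfl
    · intro k _
      by_cases h : k < i <;> by_cases h' : k < j <;> simp [h, h']
  rw [Finset.sum_congr rfl fun i hi => Finset.sum_congr rfl (h1 i hi)]
  have h2 : ∀ k, (tailCount S k : ℝ) = ∑ i ∈ S, if k < i then (1 : ℝ) else 0 := by
    intro k; rw [Finset.sum_boole]; rfl
  simp_rw [h2, sq, Finset.sum_mul_sum]
  rw [Finset.sum_congr rfl fun i _ => Finset.sum_comm, Finset.sum_comm]

lemma hasLaw_sum_brownian {Ω : Type*} [MeasurableSpace Ω] {P : Measure Ω} {W : ℝ≥0 → Ω → ℝ}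
    (hW : IsPreBrownianReal W P) (τ : ℝ≥0) (S : Finset ℕ) :
    P.map (∑ i ∈ S, W (i * τ)) =
      gaussianReal 0 (Real.toNNReal ((τ : ℝ) * ∑ i ∈ S, ∑ j ∈ S, (min i j : ℝ))) := by
  have hG : IsGaussianProcess (fun i : ℕ => W (i * τ)) P :=
    hW.isGaussianProcess.comp_right (fun i : ℕ => (i : ℝ≥0) * τ)
  have := hG.isProbabilityMeasure
  have hL : ∀ i ∈ S, MemLp (W (i * τ)) 2 P := fun i _ => (hG.hasGaussianLaw_eval i).memLp_two
  have h := (hG.hasGaussianLaw_sum (I := S)).map_eq_gaussianReal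
  rw [h]
  congr 1
  · simp only [Finset.sum_apply]
    rw [integral_finsetSum _ fun i _ => hW.integrable_eval _]
    exact Finset.sum_eq_zero fun i _ => hW.integral_eval _
  · congr 1
    rw [← covariance_self (hG.hasGaussianLaw_sum (I := S)).aemeasurable,
      covariance_sum_sum' hL hL, Finset.mul_sum]
    refine Finset.sum_congr rfl fun i _ => ?_
    rw [Finset.mul_sum]
    refine Finset.sum_congr rfl fun j _ => ?_
    rw [hW.covariance_eval]
    push_cast
    rw [mul_comm (τ : ℝ), min_mul_of_nonneg _ _ τ.coe_nonneg]

lemma integral_process_eq {Ω : Type*} [MeasurableSpace Ω] {P : Measure Ω} {W : ℝ≥0 → Ω → ℝ}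
    (hW : IsPreBrownianReal W P) (ρ σ : ℝ) (τ : ℝ≥0) (y β : ℝ) {n : ℕ} (hn : 1 ≤ n)
    (hβ : 1 / 2 * σ ^ 2 * (τ : ℝ) * (n : ℝ) ^ 2 = β) :
    ∫ ω, process W ρ σ τ y n ω ∂P = y * partitionSum n ρ β := by
  have hn0 : (n : ℝ) ≠ 0 := by positivity
  have hterm : ∀ S : Finset ℕ, ∀ ω, ∏ i ∈ S,
      (ρ * Real.exp (σ * W (i * τ) ω - σ ^ 2 / 2 * ((i * τ : ℝ≥0) : ℝ))) =
      ρ ^ S.card * Real.exp (- (σ ^ 2 / 2 * τ * ∑ i ∈ S, (i : ℝ))) *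
        Real.exp (σ * (∑ i ∈ S, W (i * τ)) ω) := by
    intro S ω
    rw [Finset.prod_mul_distrib, Finset.prod_const, ← Real.exp_sum, mul_assoc, ← Real.exp_add]
    congr 2
    rw [Finset.sum_sub_distrib, Finset.sum_apply, Finset.mul_sum, Finset.mul_sum]
    push_cast
    rw [neg_add_eq_sub]
    congr 1
    exact Finset.sum_congr rfl fun i _ => by ring
  have hmgf : ∀ S : Finset ℕ, ∫ ω, Real.exp (σ * (∑ i ∈ S, W (i * τ)) ω) ∂P =
      Real.exp (τ * (∑ i ∈ S, ∑ j ∈ S, (min i j : ℝ)) * σ ^ 2 / 2) := by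
    intro S
    have := mgf_gaussianReal (hasLaw_sum_brownian hW τ S) σ
    rw [mgf] at this
    rw [this, Real.coe_toNNReal _ (by positivity)]
    simp
  have hint : ∀ S : Finset ℕ, Integrable (fun ω => Real.exp (σ * (∑ i ∈ S, W (i * τ)) ω)) P := by
    intro S
    -- A non-integrable function would have integral 0 by convention, but the exponential moment is
    -- positive.
    by_contra h
    have h1 := hmgf S
    rw [integral_undef h] at h1
    exact (Real.exp_pos _).ne h1
  simp_rw [process_eq_prod, integral_const_mul, Finset.prod_one_add, hterm]
  rw [integral_finsetSum _ fun S _ => (hint S).const_mul _, partitionSum]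
  congr 1
  refine Finset.sum_congr rfl fun S hS => ?_
  rw [integral_const_mul, hmgf, mul_assoc, ← Real.exp_add,
    sum_min_eq_sum_tailCount_sq (Finset.mem_powerset.1 hS), ← hβ]
  congr 2
  field_simp
  ring

/-! ### Linearizing the quadratic exponent: paths and actions -/

/-- The discrete action of the path `h_0, …, h_n`. -/
noncomputable def pathAction (n : ℕ) (β : ℝ) (h : ℕ → ℝ) : ℝ :=
  ∑ i ∈ Finset.range n, Real.log (1 + Real.exp (h i)) -
    (n : ℝ) ^ 2 / (4 * β) * ∑ k ∈ Finset.range n, (h (k + 1) - h k) ^ 2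

/-- Summation by parts: h i - h 0 is the sum of the increments over k < i. -/
lemma sum_increments_mul_tailCount {n : ℕ} {S : Finset ℕ} (hS : S ⊆ Finset.range n) (h : ℕ → ℝ) :
    ∑ k ∈ Finset.range n, (h (k + 1) - h k) * tailCount S k = ∑ i ∈ S, (h i - h 0) := by
  have h2 : ∀ k, (tailCount S k : ℝ) = ∑ i ∈ S, if k < i then (1 : ℝ) else 0 := by
    intro k; rw [Finset.sum_boole]; rfl
  simp_rw [h2, Finset.mul_sum]
  rw [Finset.sum_comm]
  refine Finset.sum_congr rfl fun i hi => ?_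
  have hi' := Finset.mem_range.1 (hS hi)
  rw [← Finset.sum_range_sub]
  simp only [mul_ite, mul_one, mul_zero]
  rw [← Finset.sum_filter]
  congr 1
  ext k; simp only [Finset.mem_filter, Finset.mem_range]; omega

/-- The exponent is additive over the elements of S, so the sum over subsets is a product; e^{h 0} =
ρ makes each factor 1 + e^{h i}. -/
lemma sum_tilted_eq_exp_pathAction (n : ℕ) {ρ : ℝ} (β : ℝ) (hρ : 0 < ρ) {h : ℕ → ℝ}
    (h0 : h 0 = Real.log ρ) :
    ∑ S ∈ (Finset.range n).powerset, ρ ^ S.card *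
      Real.exp (∑ k ∈ Finset.range n, ((h (k + 1) - h k) * tailCount S k
        - (n : ℝ) ^ 2 / (4 * β) * (h (k + 1) - h k) ^ 2)) = Real.exp (pathAction n β h) := by
  rw [pathAction, sub_eq_add_neg, Real.exp_add, Real.exp_sum]
  have h1 : ∀ i ∈ Finset.range n, Real.exp (Real.log (1 + Real.exp (h i))) = 1 + Real.exp (h i) :=
    fun i _ => Real.exp_log (by positivity)
  rw [Finset.prod_congr rfl h1, Finset.prod_one_add, Finset.sum_mul]
  refine Finset.sum_congr rfl fun S hS => ?_
  rw [Finset.sum_sub_distrib, sum_increments_mul_tailCount (Finset.mem_powerset.1 hS),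
    sub_eq_add_neg, Real.exp_add, ← mul_assoc, ← Finset.mul_sum]
  congr 1
  rw [Real.exp_sum, ← Finset.prod_const, ← Finset.prod_mul_distrib]
  refine Finset.prod_congr rfl fun i _ => ?_
  rw [h0, Real.exp_sub, Real.exp_log hρ]
  field_simp

/-- Completing the square gives d T - n² d²/(4β) ≤ β T²/n² for every real d. The factor exp(-β) pays
for the term with ∑ i, since ∑ i ≤ n². -/
lemma exp_pathAction_le_partitionSum {n : ℕ} (hn : 1 ≤ n) {ρ β : ℝ} (hρ : 0 < ρ) (hβ : 0 < β)
    {h : ℕ → ℝ} (h0 : h 0 = Real.log ρ) :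
    Real.exp (-β) * Real.exp (pathAction n β h) ≤ partitionSum n ρ β := by
  rw [← sum_tilted_eq_exp_pathAction n β hρ h0, partitionSum, Finset.mul_sum]
  refine Finset.sum_le_sum fun S hS => ?_
  rw [mul_left_comm, ← Real.exp_add]
  gcongr
  have hn0 : (0 : ℝ) < n := by positivity
  have h1 : ∑ i ∈ S, (i : ℝ) ≤ (n : ℝ) ^ 2 := by
    calc ∑ i ∈ S, (i : ℝ) ≤ ∑ i ∈ Finset.range n, (i : ℝ) :=
          Finset.sum_le_sum_of_subset_of_nonneg (Finset.mem_powerset.1 hS) fun _ _ _ => by positivity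
      _ ≤ ∑ _i ∈ Finset.range n, (n : ℝ) :=
          Finset.sum_le_sum fun i hi => by exact_mod_cast (Finset.mem_range.1 hi).le
      _ = _ := by simp [sq]
  have h2 : β / (n : ℝ) ^ 2 * ∑ i ∈ S, (i : ℝ) ≤ β := by
    calc _ ≤ β / (n : ℝ) ^ 2 * (n : ℝ) ^ 2 := by gcongr
      _ = β := by field_simp
  have h3 : ∑ k ∈ Finset.range n, ((h (k + 1) - h k) * tailCount S k
        - (n : ℝ) ^ 2 / (4 * β) * (h (k + 1) - h k) ^ 2)
      ≤ β / (n : ℝ) ^ 2 * ∑ k ∈ Finset.range n, (tailCount S k : ℝ) ^ 2 := by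
    rw [Finset.mul_sum]
    refine Finset.sum_le_sum fun k _ => ?_
    have : 0 ≤ β / (n : ℝ) ^ 2 * (tailCount S k - (n : ℝ) ^ 2 / (2 * β) * (h (k + 1) - h k)) ^ 2 := by
      positivity
    have e : β / (n : ℝ) ^ 2 * (tailCount S k - (n : ℝ) ^ 2 / (2 * β) * (h (k + 1) - h k)) ^ 2 =
      β / (n : ℝ) ^ 2 * (tailCount S k : ℝ) ^ 2 - ((h (k + 1) - h k) * tailCount S k
        - (n : ℝ) ^ 2 / (4 * β) * (h (k + 1) - h k) ^ 2) := by
      field_simp; ring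
    linarith
  rw [mul_sub]
  linarith

lemma tailCount_antitone (S : Finset ℕ) {a b : ℕ} (hab : a ≤ b) :
    tailCount S b ≤ tailCount S a := by
  refine Finset.card_le_card fun i hi => ?_
  simp only [Finset.mem_filter] at hi ⊢
  exact ⟨hi.1, by omega⟩

lemma tailCount_le_add (S : Finset ℕ) (a b : ℕ) :
    tailCount S a ≤ tailCount S b + (b - a) := by
  rw [← Nat.card_Ioc a b]
  refine (Finset.card_le_card (t := S.filter (b < ·) ∪ Finset.Ioc a b) fun i hi => ?_).trans
    (Finset.card_union_le _ _)
  simp only [Finset.mem_filter, Finset.mem_union, Finset.mem_Ioc] at hi ⊢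
  by_cases h : b < i
  · exact Or.inl ⟨hi.1, h⟩
  · exact Or.inr ⟨hi.2, by omega⟩

lemma tailCount_le {n : ℕ} {S : Finset ℕ} (hS : S ⊆ Finset.range n) (k : ℕ) :
    tailCount S k ≤ n := by
  calc tailCount S k ≤ S.card := Finset.card_filter_le _ _
    _ ≤ (Finset.range n).card := Finset.card_le_card hS
    _ = n := Finset.card_range n

/-- The path whose slope is constant, proportional to `c`, on blocks of length `m`. -/
noncomputable def blockPath (n m K : ℕ) (ρ β : ℝ) (c : Fin (K + 1) → Fin (n + 1)) (k : ℕ) : ℝ :=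
  Real.log ρ + ∑ j ∈ Finset.range k, 2 * β / (n : ℝ) ^ 2 * (c (Fin.ofNat (K + 1) (j / m)) : ℕ)

/-- The square is completed exactly by the slope 2β T(k)/n². Freezing T on blocks of length m = ⌊√n⌋
+ 1 changes it by at most m, which costs β m²/n² per step and at most 4β in all, and leaves only
(n+1)^(⌊√n⌋+1) paths. These are monotone because T ≥ 0. -/
lemma partitionSum_le {n : ℕ} (hn : 1 ≤ n) {ρ β M : ℝ} (hρ : 0 < ρ) (hβ : 0 < β)
    (hM : ∀ h : ℕ → ℝ, h 0 = Real.log ρ → Monotone h → pathAction n β h ≤ M) :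
    partitionSum n ρ β ≤ ((n : ℝ) + 1) ^ (Nat.sqrt n + 1) * (Real.exp (4 * β) * Real.exp M) := by
  have hn0 : (0 : ℝ) < n := by positivity
  set K := Nat.sqrt n with hK
  set m := K + 1 with hm
  have hK1 : 1 ≤ K := Nat.sqrt_pos.2 hn
  have hKn : K * K ≤ n := Nat.sqrt_le n
  have hKn' : n < m * m := Nat.lt_succ_sqrt n
  have hm2 : (m : ℝ) ^ 2 ≤ 4 * n := by
    have : m ^ 2 ≤ 4 * n := by rw [hm]; nlinarith
    exact_mod_cast this
  let term (S : Finset ℕ) (h : ℕ → ℝ) : ℝ := ρ ^ S.card *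
      Real.exp (∑ k ∈ Finset.range n, ((h (k + 1) - h k) * tailCount S k
        - (n : ℝ) ^ 2 / (4 * β) * (h (k + 1) - h k) ^ 2))
  let c (S : Finset ℕ) : Fin (K + 1) → Fin (n + 1) := fun j => Fin.ofNat (n + 1) (tailCount S (j * m))
  have hstep : ∀ S ∈ (Finset.range n).powerset, ρ ^ S.card *
      Real.exp (β / (n : ℝ) ^ 2 *
        (∑ k ∈ Finset.range n, (tailCount S k : ℝ) ^ 2 - ∑ i ∈ S, (i : ℝ))) ≤
      Real.exp (4 * β) * term S (blockPath n m K ρ β (c S)) := by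
    intro S hS
    rw [mul_left_comm, ← Real.exp_add]
    gcongr
    have h1 : 0 ≤ β / (n : ℝ) ^ 2 * ∑ i ∈ S, (i : ℝ) := by positivity
    have h2 : β / (n : ℝ) ^ 2 * ∑ k ∈ Finset.range n, (tailCount S k : ℝ) ^ 2 ≤
        ∑ k ∈ Finset.range n, ((blockPath n m K ρ β (c S) (k + 1) - blockPath n m K ρ β (c S) k)
          * tailCount S k - (n : ℝ) ^ 2 / (4 * β) *
            (blockPath n m K ρ β (c S) (k + 1) - blockPath n m K ρ β (c S) k) ^ 2)
        + ∑ k ∈ Finset.range n, β / (n : ℝ) ^ 2 * (m : ℝ) ^ 2 := by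
      rw [Finset.mul_sum, ← Finset.sum_add_distrib]
      refine Finset.sum_le_sum fun k hk => ?_
      have hk' := Finset.mem_range.1 hk
      -- The reductions modulo `K + 1` and `n + 1` are harmless: n < m² gives k / m ≤ K, and a tail
      -- count is at most n.
      have hkm : k / m < K + 1 := Nat.div_lt_of_lt_mul (by rw [← hm]; omega)
      have hcv : ((c S (Fin.ofNat (K + 1) (k / m)) : Fin (n + 1)) : ℕ) = tailCount S (k / m * m) := by
        simp only [c, Fin.val_ofNat, Nat.mod_eq_of_lt hkm]
        exact Nat.mod_eq_of_lt (Nat.lt_succ_of_le (tailCount_le (Finset.mem_powerset.1 hS) _))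
      have hd : blockPath n m K ρ β (c S) (k + 1) - blockPath n m K ρ β (c S) k =
          2 * β / (n : ℝ) ^ 2 * tailCount S (k / m * m) := by
        rw [blockPath, blockPath, Finset.sum_range_succ, hcv]; ring
      rw [hd]
      have ha := tailCount_antitone S (Nat.div_mul_le_self k m)
      have hb := tailCount_le_add S (k / m * m) k
      have hc : k - k / m * m ≤ m := by
        have := Nat.mod_lt k (show 0 < m by omega)
        have := Nat.div_add_mod' k m
        omega
      have hb' : (tailCount S (k / m * m) : ℝ) ≤ tailCount S k + m := by
        exact_mod_cast hb.trans (by omega)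
      have ha' : (tailCount S k : ℝ) ≤ tailCount S (k / m * m) := by exact_mod_cast ha
      have hsq : ((tailCount S (k / m * m) : ℝ) - tailCount S k) ^ 2 ≤ (m : ℝ) ^ 2 :=
        pow_le_pow_left₀ (by linarith) (by linarith) 2
      have := mul_le_mul_of_nonneg_left hsq (show 0 ≤ β / (n : ℝ) ^ 2 by positivity)
      refine le_of_eq_of_le ?_ (add_le_add_right this _)
      field_simp; ring
    have h3 : ∑ k ∈ Finset.range n, β / (n : ℝ) ^ 2 * (m : ℝ) ^ 2 ≤ 4 * β := by
      rw [Finset.sum_const, Finset.card_range, nsmul_eq_mul]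
      calc (n : ℝ) * (β / (n : ℝ) ^ 2 * (m : ℝ) ^ 2) ≤ (n : ℝ) * (β / (n : ℝ) ^ 2 * (4 * n)) := by
            gcongr
        _ = 4 * β := by field_simp
    rw [mul_sub]
    linarith
  calc partitionSum n ρ β
      ≤ ∑ S ∈ (Finset.range n).powerset, Real.exp (4 * β) * term S (blockPath n m K ρ β (c S)) :=
        Finset.sum_le_sum hstep
    _ ≤ ∑ S ∈ (Finset.range n).powerset, Real.exp (4 * β) *
          ∑ c : Fin (K + 1) → Fin (n + 1), term S (blockPath n m K ρ β c) := by
        -- Enlarging the term of the path adapted to S to a sum over all `c` decouples the path from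
        -- S; for fixed `c` the sum over S is then exact.
        refine Finset.sum_le_sum fun S _ => ?_
        gcongr
        exact Finset.single_le_sum (f := fun c => term S (blockPath n m K ρ β c))
          (fun _ _ => by positivity) (Finset.mem_univ _)
    _ = ∑ c : Fin (K + 1) → Fin (n + 1), Real.exp (4 * β) *
          Real.exp (pathAction n β (blockPath n m K ρ β c)) := by
        rw [← Finset.mul_sum, Finset.sum_comm, ← Finset.mul_sum]
        congr 1
        refine Finset.sum_congr rfl fun c _ => ?_
        exact sum_tilted_eq_exp_pathAction n β hρ (by simp [blockPath])
    _ ≤ ∑ c : Fin (K + 1) → Fin (n + 1), Real.exp (4 * β) * Real.exp M := by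
        refine Finset.sum_le_sum fun c _ => ?_
        gcongr
        refine hM _ (by simp [blockPath]) (monotone_nat_of_le_succ fun k => ?_)
        rw [blockPath, blockPath, Finset.sum_range_succ]
        have : 0 ≤ 2 * β / (n : ℝ) ^ 2 * ((c (Fin.ofNat (K + 1) (k / m)) : ℕ) : ℝ) := by positivity
        linarith
    _ = _ := by simp [hm]

/-! ### From paths to the endpoint functional -/

/-- The gap `log ((1 + e^a) / (1 + e^x))`. -/
noncomputable def gap (a x : ℝ) : ℝ := Real.log ((1 + Real.exp a) / (1 + Real.exp x))

lemma gap_eq_sub (a x : ℝ) : gap a x = Real.log (1 + Real.exp a) - Real.log (1 + Real.exp x) :=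
  Real.log_div (by positivity) (by positivity)

lemma gap_strictAnti (a : ℝ) : StrictAnti (gap a) := by
  intro x y h
  rw [gap_eq_sub, gap_eq_sub]
  have := Real.log_lt_log (by positivity) (add_lt_add_right (Real.exp_lt_exp.2 h) 1)
  linarith

lemma gap_self (a : ℝ) : gap a a = 0 := by rw [gap_eq_sub, sub_self]

lemma gap_nonneg {a x : ℝ} (h : x ≤ a) : 0 ≤ gap a x :=
  gap_self a ▸ (gap_strictAnti a).antitone h

lemma gap_pos {a x : ℝ} (h : x < a) : 0 < gap a x := gap_self a ▸ gap_strictAnti a h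

lemma continuous_gap (a : ℝ) : Continuous (gap a) :=
  Continuous.log (continuous_const.div (by fun_prop) fun x => by positivity)
    fun x => by positivity

lemma continuous_sqrt_gap (a : ℝ) : Continuous fun x => √(gap a x) := (continuous_gap a).sqrt

lemma reducedFunctional_eq (ρ β a : ℝ) : reducedFunctional ρ β a =
    Real.log (1 + Real.exp a) - 1 / √β * ∫ x in (Real.log ρ)..a, √(gap a x) := rfl

lemma slopeIntegral_eq (a ρ : ℝ) :
    slopeIntegral a ρ = ∫ x in (Real.log ρ)..a, 1 / √(gap a x) := rfl

/-- AM-GM on potential deficit and kinetic energy: gap + n² d²/(4β) ≥ n d √gap / √β. Since the gap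
decreases in x, d √gap at the left endpoint is an upper rectangle for ∫ √gap, so the discretization
costs nothing here. -/
lemma pathAction_le {n : ℕ} {ρ β : ℝ} (hβ : 0 < β) {h : ℕ → ℝ}
    (h0 : h 0 = Real.log ρ) (hm : Monotone h) :
    pathAction n β h ≤ n * reducedFunctional ρ β (h n) := by
  set a := h n with ha
  have hs : 0 < √β := Real.sqrt_pos.2 hβ
  have hint : ∑ k ∈ Finset.range n, ∫ x in (h k)..(h (k + 1)), √(gap a x) =
      ∫ x in (Real.log ρ)..a, √(gap a x) := by
    rw [intervalIntegral.sum_integral_adjacent_intervals fun k _ =>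
      (continuous_sqrt_gap a).intervalIntegrable _ _, h0]
  have key : ∀ k ∈ Finset.range n, Real.log (1 + Real.exp (h k)) -
      (n : ℝ) ^ 2 / (4 * β) * (h (k + 1) - h k) ^ 2 ≤
      Real.log (1 + Real.exp a) - n * (1 / √β * ∫ x in (h k)..(h (k + 1)), √(gap a x)) := by
    intro k hk
    have hka : h k ≤ a := hm (Finset.mem_range.1 hk).le
    have hkk : h k ≤ h (k + 1) := hm k.le_succ
    have h1 : ∫ x in (h k)..(h (k + 1)), √(gap a x) ≤ (h (k + 1) - h k) * √(gap a (h k)) := by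
      calc _ ≤ ∫ x in (h k)..(h (k + 1)), √(gap a (h k)) := by
            refine intervalIntegral.integral_mono_on hkk
              ((continuous_sqrt_gap a).intervalIntegrable _ _) (by simp) fun x hx => ?_
            exact Real.sqrt_le_sqrt ((gap_strictAnti a).antitone hx.1)
        _ = _ := by simp
    have h2 : n * (1 / √β * ∫ x in (h k)..(h (k + 1)), √(gap a x)) ≤
        n * (1 / √β * ((h (k + 1) - h k) * √(gap a (h k)))) := by gcongr
    have h3 := sq_nonneg (√(gap a (h k)) - n * (h (k + 1) - h k) / (2 * √β))
    have h4 : (√(gap a (h k)) - n * (h (k + 1) - h k) / (2 * √β)) ^ 2 =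
        gap a (h k) + (n : ℝ) ^ 2 / (4 * β) * (h (k + 1) - h k) ^ 2 -
        n * (1 / √β * ((h (k + 1) - h k) * √(gap a (h k)))) := by
      rw [sub_sq, Real.sq_sqrt (gap_nonneg hka), div_pow, mul_pow, mul_pow, Real.sq_sqrt hβ.le]
      field_simp
      ring
    have h5 := gap_eq_sub a (h k)
    linarith
  calc pathAction n β h = ∑ k ∈ Finset.range n, (Real.log (1 + Real.exp (h k)) -
      (n : ℝ) ^ 2 / (4 * β) * (h (k + 1) - h k) ^ 2) := by
        rw [pathAction, Finset.sum_sub_distrib, Finset.mul_sum]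
    _ ≤ _ := Finset.sum_le_sum key
    _ = _ := by
      rw [Finset.sum_sub_distrib, ← Finset.mul_sum, ← Finset.mul_sum, hint, reducedFunctional_eq]
      simp; ring

/-- Equality in AM-GM means n d = 2√β √gap, so the travel time is measured by ∫ dx/√gap, and the
hypothesis on F fixes the total time. The path visits points separated by equal travel times 2√β/n.
-/
lemma exists_le_pathAction {n : ℕ} (hn : 1 ≤ n) {ρ β a : ℝ} (hβ : 0 < β)
    (ha : Real.log ρ ≤ a) (hF : slopeIntegral a ρ = 2 * √β) :
    ∃ h : ℕ → ℝ, h 0 = Real.log ρ ∧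
      n * reducedFunctional ρ β a - 2 * gap a (Real.log ρ) ≤ pathAction n β h := by
  have hn0 : (0 : ℝ) < n := by positivity
  have hs : 0 < √β := Real.sqrt_pos.2 hβ
  rw [slopeIntegral_eq] at hF
  set w : ℝ → ℝ := fun x => 1 / √(gap a x) with hw
  set b := Real.log ρ with hb
  have hwint : IntervalIntegrable w volume b a := by
    -- Integrability at the singular end x = a is free: an undefined integral would be 0, not 2√β.
    by_contra hc
    rw [intervalIntegral.integral_undef hc] at hF
    linarith
  have hwsub : ∀ x ∈ Icc b a, ∀ y ∈ Icc b a, IntervalIntegrable w volume x y := by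
    intro x hx y hy
    refine hwint.mono_set ?_
    rw [uIcc_of_le ha]
    exact uIcc_subset_Icc hx hy
  have hw0 : ∀ x, 0 ≤ w x := fun x => by positivity
  have hbm : b ∈ Icc b a := ⟨le_rfl, ha⟩
  have ham : a ∈ Icc b a := ⟨ha, le_rfl⟩
  have hcont : ContinuousOn (fun x => ∫ t in b..x, w t) (Icc b a) := by
    have := intervalIntegral.continuousOn_primitive_interval (f := w) (μ := volume) (a := b) (b := a)
      ((intervalIntegrable_iff' (by simp)).1 hwint)
    rwa [uIcc_of_le ha] at this
  have hex : ∀ i : ℕ, ∃ x ∈ Icc b a, (i = 0 → x = b) ∧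
      (i ≤ n → ∫ t in b..x, w t = 2 * √β * i / n) := by
    intro i
    rcases Nat.eq_zero_or_pos i with rfl | hi
    · exact ⟨b, hbm, by simp, by simp⟩
    by_cases hin : i ≤ n
    · have hin' : (i : ℝ) ≤ n := by exact_mod_cast hin
      obtain ⟨x, hx, hx'⟩ := intermediate_value_Icc ha hcont
        (show 2 * √β * i / n ∈ Icc (∫ t in b..b, w t) (∫ t in b..a, w t) by
          rw [hF, intervalIntegral.integral_same]
          exact ⟨by positivity, by rw [div_le_iff₀ hn0]; gcongr⟩)
      exact ⟨x, hx, fun h => by omega, fun _ => hx'⟩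
    · exact ⟨b, hbm, fun h => by omega, fun h => absurd h hin⟩
  choose h hmem h0 hT using hex
  refine ⟨h, h0 0 rfl, ?_⟩
  have hTd : ∀ k < n, ∫ t in (h k)..(h (k + 1)), w t = 2 * √β / n := by
    intro k hk
    rw [← intervalIntegral.integral_interval_sub_left (hwsub b hbm _ (hmem _))
      (hwsub b hbm _ (hmem _)), hT _ hk, hT _ hk.le]
    push_cast; ring
  have hlt : ∀ k < n, h k < h (k + 1) := by
    intro k hk
    by_contra hc
    have h1 := intervalIntegral.integral_nonneg (f := w) (μ := volume) (not_lt.1 hc)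
      (fun x _ => hw0 x)
    rw [intervalIntegral.integral_symm, hTd k hk] at h1
    have : 0 < 2 * √β / n := by positivity
    linarith
  have hstep : ∀ k < n, (n : ℝ) ^ 2 / (4 * β) * (h (k + 1) - h k) ^ 2 ≤ gap a (h k) := by
    intro k hk
    have hka : h k < a := (hlt k hk).trans_le (hmem _).2
    have hg := gap_pos hka
    have hsg : 0 < √(gap a (h k)) := Real.sqrt_pos.2 hg
    have h1 : (h (k + 1) - h k) * w (h k) ≤ 2 * √β / n := by
      rw [← hTd k hk]
      calc (h (k + 1) - h k) * w (h k) = ∫ x in (h k)..(h (k + 1)), w (h k) := by simp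
        _ ≤ _ := by
          -- The interval must be open: at x = a the value of `w` is 1/0 = 0 and the comparison
          -- fails.
          refine intervalIntegral.integral_mono_on_of_le_Ioo (hlt k hk).le (by simp)
            (hwsub _ (hmem _) _ (hmem _)) fun x hx => ?_
          have := gap_pos (hx.2.trans_le (hmem _).2)
          exact one_div_le_one_div_of_le (Real.sqrt_pos.2 this)
            (Real.sqrt_le_sqrt ((gap_strictAnti a).antitone hx.1.le))
    have h2 : h (k + 1) - h k ≤ 2 * √β / n * √(gap a (h k)) := by
      rw [hw, mul_one_div, div_le_iff₀ hsg] at h1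
      exact h1
    have h3 : (h (k + 1) - h k) ^ 2 ≤ (2 * √β / n * √(gap a (h k))) ^ 2 :=
      pow_le_pow_left₀ (by linarith [hlt k hk]) h2 2
    rw [mul_pow, div_pow, mul_pow, Real.sq_sqrt hg.le, Real.sq_sqrt hβ.le] at h3
    calc _ ≤ (n : ℝ) ^ 2 / (4 * β) * (2 ^ 2 * β / n ^ 2 * gap a (h k)) := by gcongr
      _ = _ := by field_simp; norm_num
  have hsqrt : ∀ k < n, 2 * √β / n * gap a (h (k + 1)) ≤
      ∫ x in (h k)..(h (k + 1)), √(gap a x) := by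
    intro k hk
    rw [← hTd k hk, mul_comm, ← intervalIntegral.integral_const_mul]
    refine intervalIntegral.integral_mono_on_of_le_Ioo (hlt k hk).le
      ((hwsub _ (hmem _) _ (hmem _)).const_mul _)
      ((continuous_sqrt_gap a).intervalIntegrable _ _) fun x hx => ?_
    have hg := gap_pos (hx.2.trans_le (hmem (k + 1)).2)
    have hsg : 0 < √(gap a x) := Real.sqrt_pos.2 hg
    rw [hw, mul_one_div, div_le_iff₀ hsg, Real.mul_self_sqrt hg.le]
    exact (gap_strictAnti a).antitone hx.2.le
  have hsum : 2 * √β / n * ∑ k ∈ Finset.range n, gap a (h (k + 1)) ≤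
      ∫ x in b..a, √(gap a x) := by
    calc _ ≤ ∑ k ∈ Finset.range n, ∫ x in (h k)..(h (k + 1)), √(gap a x) := by
          rw [Finset.mul_sum]
          exact Finset.sum_le_sum fun k hk => hsqrt k (Finset.mem_range.1 hk)
      _ = ∫ x in b..(h n), √(gap a x) := by
          rw [intervalIntegral.sum_integral_adjacent_intervals fun k _ =>
            (continuous_sqrt_gap a).intervalIntegrable _ _, h0 0 rfl]
      _ ≤ _ := by
          refine intervalIntegral.integral_mono_interval le_rfl (hmem n).1 (hmem n).2
            (Eventually.of_forall fun x => Real.sqrt_nonneg _)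
            ((continuous_sqrt_gap a).intervalIntegrable _ _)
  have hsum' : 2 * ∑ k ∈ Finset.range n, gap a (h (k + 1)) ≤
      n * (1 / √β * ∫ x in b..a, √(gap a x)) := by
    calc _ = n * (1 / √β * (2 * √β / n * ∑ k ∈ Finset.range n, gap a (h (k + 1)))) := by
          field_simp
      _ ≤ _ := by gcongr
  -- The kinetic bound involves gaps at left endpoints, the integral bound gaps at right endpoints;
  -- the two sums differ by at most the initial gap.
  have hshift : ∑ k ∈ Finset.range n, gap a (h k) ≤
      ∑ k ∈ Finset.range n, gap a (h (k + 1)) + gap a b := by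
    have := Finset.sum_range_succ' (fun k => gap a (h k)) n
    rw [Finset.sum_range_succ, h0 0 rfl] at this
    have := gap_nonneg (hmem n).2
    linarith
  have hkin : (n : ℝ) ^ 2 / (4 * β) * ∑ k ∈ Finset.range n, (h (k + 1) - h k) ^ 2 ≤
      ∑ k ∈ Finset.range n, gap a (h k) := by
    rw [Finset.mul_sum]
    exact Finset.sum_le_sum fun k hk => hstep k (Finset.mem_range.1 hk)
  have hpot : ∑ k ∈ Finset.range n, Real.log (1 + Real.exp (h k)) =
      n * Real.log (1 + Real.exp a) - ∑ k ∈ Finset.range n, gap a (h k) := by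
    simp_rw [gap_eq_sub a, Finset.sum_sub_distrib]
    simp
  rw [pathAction, hpot, reducedFunctional_eq, mul_sub]
  linarith

/-! ### The limit defining the Lyapunov exponent -/

lemma partitionSum_pos (n : ℕ) {ρ : ℝ} (β : ℝ) (hρ : 0 < ρ) : 0 < partitionSum n ρ β :=
  Finset.sum_pos (fun S _ => by positivity) ⟨∅, Finset.empty_mem_powerset _⟩

/-- The logarithm of the number of block paths is negligible against n. -/
lemma tendsto_sqrt_mul_log_div :
    Tendsto (fun n : ℕ => 1 / (n : ℝ) * ((Nat.sqrt n + 1 : ℕ) * Real.log ((n : ℝ) + 1)))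
      atTop (𝓝 0) := by
  have h1 : Tendsto (fun n : ℕ => 4 * (Real.log ((n : ℝ) + 1) / √((n : ℝ) + 1))) atTop (𝓝 0) := by
    have h := (isLittleO_log_rpow_atTop (show (0 : ℝ) < 1 / 2 by norm_num)).tendsto_div_nhds_zero
    have h' := (h.comp (tendsto_atTop_add_const_right atTop (1 : ℝ)
      tendsto_natCast_atTop_atTop)).const_mul 4
    simpa [Function.comp_def, Real.sqrt_eq_rpow] using h'
  refine squeeze_zero' (Eventually.of_forall fun n => ?_) ?_ h1
  · have : 0 ≤ Real.log ((n : ℝ) + 1) := Real.log_nonneg (by simp)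
    positivity
  · filter_upwards [eventually_ge_atTop 1] with n hn
    have hn0 : (0 : ℝ) < n := by positivity
    have hn1 : (1 : ℝ) ≤ n := by exact_mod_cast hn
    have hlog : 0 ≤ Real.log ((n : ℝ) + 1) := Real.log_nonneg (by simp)
    have hs : 0 < √((n : ℝ) + 1) := Real.sqrt_pos.2 (by positivity)
    have hK1 : 1 ≤ Nat.sqrt n := Nat.sqrt_pos.2 hn
    have hKn : Nat.sqrt n * Nat.sqrt n ≤ n := Nat.sqrt_le n
    have hK : ((Nat.sqrt n + 1 : ℕ) : ℝ) ^ 2 ≤ 4 * n := by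
      have : (Nat.sqrt n + 1) ^ 2 ≤ 4 * n := by nlinarith
      exact_mod_cast this
    have h2 : ((Nat.sqrt n + 1 : ℕ) : ℝ) * √((n : ℝ) + 1) ≤ 4 * n := by
      refine abs_le_of_sq_le_sq' ?_ (by positivity) |>.2
      rw [mul_pow, Real.sq_sqrt (by positivity)]
      nlinarith
    calc _ = ((Nat.sqrt n + 1 : ℕ) * √((n : ℝ) + 1)) / n *
          (Real.log ((n : ℝ) + 1) / √((n : ℝ) + 1)) := by field_simp
      _ ≤ 4 * n / n * (Real.log ((n : ℝ) + 1) / √((n : ℝ) + 1)) := by gcongr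
      _ = _ := by field_simp

lemma log_partitionSum_le {n : ℕ} (hn : 1 ≤ n) {ρ β a : ℝ} (hρ : 0 < ρ) (hβ : 0 < β)
    (hmax : IsMaxOn (reducedFunctional ρ β) (Ici (Real.log ρ)) a) :
    Real.log (partitionSum n ρ β) ≤
      (Nat.sqrt n + 1 : ℕ) * Real.log ((n : ℝ) + 1) + 4 * β + n * reducedFunctional ρ β a := by
  have h := partitionSum_le (M := n * reducedFunctional ρ β a) hn hρ hβ fun h h0 hm =>
    (pathAction_le hβ h0 hm).trans <| by
      gcongr
      exact hmax (show Real.log ρ ≤ h n from h0 ▸ hm n.zero_le)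
  have := Real.log_le_log (partitionSum_pos n β hρ) h
  rwa [Real.log_mul (by positivity) (by positivity), Real.log_pow, ← Real.exp_add, Real.log_exp,
    ← add_assoc] at this

lemma le_log_partitionSum {n : ℕ} (hn : 1 ≤ n) {ρ β a : ℝ} (hρ : 0 < ρ) (hβ : 0 < β)
    (ha : Real.log ρ ≤ a) (hF : slopeIntegral a ρ = 2 * √β) :
    n * reducedFunctional ρ β a - 2 * gap a (Real.log ρ) - β ≤ Real.log (partitionSum n ρ β) := by
  obtain ⟨h, h0, hA⟩ := exists_le_pathAction hn hβ ha hF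
  have := Real.log_le_log (by positivity) (exp_pathAction_le_partitionSum hn hρ hβ h0)
  rw [← Real.exp_add, Real.log_exp] at this
  linarith

theorem hasLyapunovExponent_reducedFunctional {Ω : Type*} [MeasurableSpace Ω] {P : Measure Ω}
    {W : ℝ≥0 → Ω → ℝ} (hW : IsPreBrownianReal W P) {ρ β a : ℝ} (hρ : 0 < ρ) (hβ : 0 < β)
    (ha : IsOptimalEndpoint ρ β a) (hF : slopeIntegral a ρ = 2 * √β) :
    HasLyapunovExponent W P ρ β (reducedFunctional ρ β a) := by
  intro y σ τ hy hσ hτ hστ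
  set Λ := reducedFunctional ρ β a
  set g := gap a (Real.log ρ)
  have hlow : Tendsto (fun n : ℕ => Λ + 1 / (n : ℝ) * (Real.log y - 2 * g - β)) atTop (𝓝 Λ) := by
    simpa using (tendsto_one_div_atTop_nhds_zero_nat.mul_const _).const_add Λ
  have hupp : Tendsto (fun n : ℕ => Λ + 1 / (n : ℝ) * (Real.log y + 4 * β) +
      1 / (n : ℝ) * ((Nat.sqrt n + 1 : ℕ) * Real.log ((n : ℝ) + 1))) atTop (𝓝 Λ) := by
    simpa using ((tendsto_one_div_atTop_nhds_zero_nat.mul_const _).const_add Λ).add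
      tendsto_sqrt_mul_log_div
  refine tendsto_of_tendsto_of_tendsto_of_le_of_le' hlow hupp ?_ ?_
  all_goals
    filter_upwards [eventually_ge_atTop 1] with n hn
    have hn0 : (0 : ℝ) < n := by positivity
    rw [integral_process_eq hW ρ (σ n) (τ n) y β hn (hστ n hn),
      Real.log_mul hy.ne' (partitionSum_pos n β hρ).ne']
    have h1 := log_partitionSum_le hn hρ hβ ha.2
    have h2 := le_log_partitionSum hn hρ hβ ha.1 hF
  · calc _ = 1 / (n : ℝ) * (Real.log y + (n * Λ - 2 * g - β)) := by field_simp; ring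
      _ ≤ _ := by gcongr
  · calc _ ≤ 1 / (n : ℝ) * (Real.log y + ((Nat.sqrt n + 1 : ℕ) * Real.log ((n : ℝ) + 1) +
          4 * β + n * Λ)) := by gcongr
      _ = _ := by field_simp; ring

/-! ### The maximum of H -/

/-- `∫_0^x e^{t²} dt`. -/
noncomputable def expSqIntegral (x : ℝ) : ℝ := ∫ t in (0 : ℝ)..x, Real.exp (t ^ 2)

lemma dawsonProduct_eq (x : ℝ) :
    dawsonProduct x = 2 * x * Real.exp (-x ^ 2) * expSqIntegral x := rfl

lemma hasDerivAt_expSqIntegral (x : ℝ) : HasDerivAt expSqIntegral (Real.exp (x ^ 2)) x :=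
  (show Continuous fun t : ℝ => Real.exp (t ^ 2) by fun_prop).integral_hasStrictDerivAt 0 x
    |>.hasDerivAt

lemma expSqIntegral_nonneg {x : ℝ} (hx : 0 ≤ x) : 0 ≤ expSqIntegral x :=
  intervalIntegral.integral_nonneg hx fun _ _ => (Real.exp_pos _).le

/-- The Taylor coefficients of Dawson's function: the coefficient of `x^{2k+1}`. -/
noncomputable def dawsonCoeff : ℕ → ℝ
  | 0 => 1
  | k + 1 => -2 * dawsonCoeff k / (2 * k + 3)

/-- The Taylor polynomials of Dawson's function. -/
noncomputable def dawsonPoly (N : ℕ) (x : ℝ) : ℝ :=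
  ∑ k ∈ Finset.range N, dawsonCoeff k * x ^ (2 * k + 1)

/-- The coefficients solve D' = 1 - 2xD, the equation of D = e^{-x²} ∫_0^x e^{t²} dt, up to one
truncation term. -/
lemma sum_deriv_dawsonPoly (N : ℕ) (x : ℝ) :
    ∑ k ∈ Finset.range N, dawsonCoeff k * (((2 * k + 1 : ℕ) : ℝ) * x ^ (2 * k)) =
      1 - (2 * N + 1) * dawsonCoeff N * x ^ (2 * N) - 2 * x * dawsonPoly N x := by
  induction N with
  | zero => simp [dawsonPoly, dawsonCoeff]
  | succ N ih =>
    have hp : dawsonPoly (N + 1) x = dawsonPoly N x + dawsonCoeff N * x ^ (2 * N + 1) :=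
      Finset.sum_range_succ _ _
    have hc : (2 * (N : ℝ) + 3) * dawsonCoeff (N + 1) = -2 * dawsonCoeff N := by
      rw [dawsonCoeff]; field_simp
    rw [hp, Finset.sum_range_succ, ih]
    push_cast
    linear_combination x ^ (2 * N + 2) * hc

lemma hasDerivAt_dawsonPoly (N : ℕ) (x : ℝ) : HasDerivAt (dawsonPoly N)
    (1 - (2 * N + 1) * dawsonCoeff N * x ^ (2 * N) - 2 * x * dawsonPoly N x) x := by
  rw [← sum_deriv_dawsonPoly]
  exact HasDerivAt.fun_sum fun k _ => (hasDerivAt_pow (2 * k + 1) x).const_mul (dawsonCoeff k)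

lemma hasDerivAt_exp_mul_dawsonPoly_sub (N : ℕ) (x : ℝ) :
    HasDerivAt (fun x => Real.exp (x ^ 2) * dawsonPoly N x - expSqIntegral x)
      (-((2 * N + 1) * dawsonCoeff N) * (Real.exp (x ^ 2) * x ^ (2 * N))) x := by
  have h := (((hasDerivAt_pow 2 x).exp).mul (hasDerivAt_dawsonPoly N x)).sub
    (hasDerivAt_expSqIntegral x)
  refine h.congr_deriv ?_
  simp
  ring

lemma dawsonPoly_zero (N : ℕ) : dawsonPoly N 0 = 0 := by simp [dawsonPoly]

lemma expSqIntegral_zero : expSqIntegral 0 = 0 := by simp [expSqIntegral]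

/-- The truncation error vanishes at 0 and its derivative has the sign opposite to the first omitted
coefficient, so truncations enclose the integral from both sides. -/
lemma expSqIntegral_le_of_coeff_nonpos {N : ℕ} (hN : dawsonCoeff N ≤ 0) {x : ℝ} (hx : 0 ≤ x) :
    expSqIntegral x ≤ Real.exp (x ^ 2) * dawsonPoly N x := by
  have hm : Monotone fun x => Real.exp (x ^ 2) * dawsonPoly N x - expSqIntegral x := by
    refine monotone_of_deriv_nonneg
      (fun y => (hasDerivAt_exp_mul_dawsonPoly_sub N y).differentiableAt) fun y => ?_
    rw [(hasDerivAt_exp_mul_dawsonPoly_sub N y).deriv, ← mul_neg]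
    have : 0 ≤ y ^ (2 * N) := (even_two_mul N).pow_nonneg y
    have : 0 ≤ -dawsonCoeff N := by linarith
    positivity
  have := hm hx
  simp only [dawsonPoly_zero, expSqIntegral_zero] at this
  linarith

lemma le_expSqIntegral_of_coeff_nonneg {N : ℕ} (hN : 0 ≤ dawsonCoeff N) {x : ℝ} (hx : 0 ≤ x) :
    Real.exp (x ^ 2) * dawsonPoly N x ≤ expSqIntegral x := by
  have hm : Antitone fun x => Real.exp (x ^ 2) * dawsonPoly N x - expSqIntegral x := by
    refine antitone_of_deriv_nonpos
      (fun y => (hasDerivAt_exp_mul_dawsonPoly_sub N y).differentiableAt) fun y => ?_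
    rw [(hasDerivAt_exp_mul_dawsonPoly_sub N y).deriv, neg_mul, neg_nonpos]
    have : 0 ≤ y ^ (2 * N) := (even_two_mul N).pow_nonneg y
    positivity
  have := hm hx
  simp only [dawsonPoly_zero, expSqIntegral_zero] at this
  linarith

lemma expSqIntegral_upper : expSqIntegral 1.501 ≤ Real.exp (1.501 ^ 2) * 0.42802 := by
  refine (expSqIntegral_le_of_coeff_nonpos (N := 13) ?_ (by norm_num)).trans ?_
  · norm_num [dawsonCoeff]
  · gcongr
    norm_num [dawsonPoly, dawsonCoeff, Finset.sum_range_succ]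

lemma expSqIntegral_lower : Real.exp (1.5 ^ 2) * 0.4282 ≤ expSqIntegral 1.5 := by
  refine le_trans ?_ (le_expSqIntegral_of_coeff_nonneg (N := 12) ?_ (by norm_num))
  · gcongr
    norm_num [dawsonPoly, dawsonCoeff, Finset.sum_range_succ]
  · norm_num [dawsonCoeff]

lemma expSqIntegral_lower' : Real.exp (1.51 ^ 2) * 0.4252 ≤ expSqIntegral 1.51 := by
  refine le_trans ?_ (le_expSqIntegral_of_coeff_nonneg (N := 12) ?_ (by norm_num))
  · gcongr
    norm_num [dawsonPoly, dawsonCoeff, Finset.sum_range_succ]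
  · norm_num [dawsonCoeff]

/-- The function whose sign on `x > 1/√2` is that of the derivative of `dawsonProduct`. -/
noncomputable def dawsonDefect (x : ℝ) : ℝ :=
  Real.exp (x ^ 2) * (x / (2 * x ^ 2 - 1)) - expSqIntegral x

lemma hasDerivAt_dawsonProduct (x : ℝ) : HasDerivAt dawsonProduct
    (2 * x - 2 * (2 * x ^ 2 - 1) * (Real.exp (-x ^ 2) * expSqIntegral x)) x := by
  have h := (((hasDerivAt_id x).const_mul 2).mul ((hasDerivAt_pow 2 x).neg.exp)).mul
    (hasDerivAt_expSqIntegral x)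
  refine h.congr_deriv ?_
  have : Real.exp (-x ^ 2) * Real.exp (x ^ 2) = 1 := by rw [← Real.exp_add]; simp
  simp
  linear_combination 2 * x * this

lemma deriv_dawsonProduct_eq {x : ℝ} (hx : 0 < 2 * x ^ 2 - 1) :
    2 * x - 2 * (2 * x ^ 2 - 1) * (Real.exp (-x ^ 2) * expSqIntegral x) =
      2 * (2 * x ^ 2 - 1) * Real.exp (-x ^ 2) * dawsonDefect x := by
  have : Real.exp (-x ^ 2) * Real.exp (x ^ 2) = 1 := by rw [← Real.exp_add]; simp
  rw [dawsonDefect]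
  field_simp
  linear_combination -x * this

/-- Once H' is divided by 2x² - 1 (and positive factors), differentiation eliminates the integral
and leaves -2e^{x²}/(2x²-1)². One sign check at 1.501 and one at 1.51 therefore control H' on whole
half-lines. -/
lemma antitoneOn_dawsonDefect : AntitoneOn dawsonDefect (Ioi √(1 / 2)) := by
  have hpos : ∀ x ∈ Ioi √(1 / 2 : ℝ), 0 < 2 * x ^ 2 - 1 := fun x hx => by
    have := Real.lt_sq_of_sqrt_lt hx
    linarith
  have hd : ∀ x ∈ Ioi √(1 / 2 : ℝ),
      HasDerivAt dawsonDefect (-2 * Real.exp (x ^ 2) / (2 * x ^ 2 - 1) ^ 2) x := by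
    intro x hx
    have h0 := hpos x hx
    have h := (((hasDerivAt_pow 2 x).exp).mul ((hasDerivAt_id x).div
      (((hasDerivAt_pow 2 x).const_mul 2).sub_const 1) h0.ne')).sub (hasDerivAt_expSqIntegral x)
    refine h.congr_deriv ?_
    simp
    obtain ⟨d, hd⟩ : ∃ d, d = 2 * x ^ 2 - 1 := ⟨_, rfl⟩
    rw [← hd] at h0 ⊢
    field_simp
    rw [hd]
    ring
  refine antitoneOn_of_deriv_nonpos (convex_Ioi _)
    (fun x hx => (hd x hx).continuousAt.continuousWithinAt)
    (fun x hx => (hd x (interior_subset hx)).differentiableAt.differentiableWithinAt)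
    fun x hx => ?_
  rw [(hd x (interior_subset hx)).deriv]
  have : 0 ≤ 2 * Real.exp (x ^ 2) / (2 * x ^ 2 - 1) ^ 2 := by positivity
  rw [neg_mul, neg_div]
  linarith

lemma continuous_dawsonProduct : Continuous dawsonProduct :=
  continuous_iff_continuousAt.2 fun x => (hasDerivAt_dawsonProduct x).continuousAt

lemma sqrt_half_lt {x : ℝ} (hx : 1 ≤ x) : √(1 / 2) < x := by
  rw [Real.sqrt_lt' (by linarith)]; nlinarith

lemma monotoneOn_dawsonProduct : MonotoneOn dawsonProduct (Icc 0 1.501) := by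
  refine monotoneOn_of_deriv_nonneg (convex_Icc _ _) continuous_dawsonProduct.continuousOn
    (fun x _ => (hasDerivAt_dawsonProduct x).differentiableAt.differentiableWithinAt)
    fun x hx => ?_
  rw [interior_Icc] at hx
  rw [(hasDerivAt_dawsonProduct x).deriv]
  rcases le_or_gt x √(1 / 2) with h | h
  · have h1 : x ^ 2 ≤ 1 / 2 := (Real.le_sqrt' hx.1).1 h
    have h2 := mul_nonneg (Real.exp_pos (-x ^ 2)).le (expSqIntegral_nonneg hx.1.le)
    nlinarith [hx.1, mul_nonneg (show 0 ≤ 1 - 2 * x ^ 2 by linarith) h2]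
  · have h0 := Real.lt_sq_of_sqrt_lt h
    rw [deriv_dawsonProduct_eq (by linarith)]
    have h1 := antitoneOn_dawsonDefect (mem_Ioi.2 h) (sqrt_half_lt (by norm_num)) hx.2.le
    have h2 : 0 ≤ dawsonDefect 1.501 := by
      have := expSqIntegral_upper
      rw [dawsonDefect, sub_nonneg]
      refine this.trans ?_
      gcongr
      norm_num
    have : 0 ≤ 2 * x ^ 2 - 1 := by linarith
    have := h2.trans h1
    positivity

lemma antitoneOn_dawsonProduct : AntitoneOn dawsonProduct (Ici 1.51) := by
  refine antitoneOn_of_deriv_nonpos (convex_Ici _) continuous_dawsonProduct.continuousOn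
    (fun x _ => (hasDerivAt_dawsonProduct x).differentiableAt.differentiableWithinAt)
    fun x hx => ?_
  rw [interior_Ici, mem_Ioi] at hx
  rw [(hasDerivAt_dawsonProduct x).deriv]
  have hx1 : √(1 / 2) < x := sqrt_half_lt (by linarith)
  have h0 := Real.lt_sq_of_sqrt_lt hx1
  rw [deriv_dawsonProduct_eq (by linarith)]
  have h1 := antitoneOn_dawsonDefect (sqrt_half_lt (by norm_num)) (mem_Ioi.2 hx1) hx.le
  have h2 : dawsonDefect 1.51 ≤ 0 := by
    have := expSqIntegral_lower'
    rw [dawsonDefect, sub_nonpos]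
    refine le_trans ?_ this
    gcongr
    norm_num
  have : 0 ≤ 2 * x ^ 2 - 1 := by linarith
  exact mul_nonpos_of_nonneg_of_nonpos (by positivity) (h1.trans h2)

/-- At the maximizer H' = 0 gives H(x₀) = 2x₀²/(2x₀²-1), so x₀ ≥ 1.501 bounds H(x₀) above; H(1.5)
bounds it below. -/
lemma exists_isMaxOn_dawsonProduct : ∃ x₀ : ℝ, 0 < x₀ ∧ IsMaxOn dawsonProduct (Ici 0) x₀ ∧
    |dawsonProduct x₀ - 1.285| < 0.0005 := by
  obtain ⟨x₀, hx₀, hmax⟩ := (isCompact_Icc (a := (1.501 : ℝ)) (b := 1.51)).exists_isMaxOn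
    ⟨1.501, by norm_num⟩ continuous_dawsonProduct.continuousOn
  have hpos : 0 < x₀ := by linarith [hx₀.1]
  have hglob : IsMaxOn dawsonProduct (Ici 0) x₀ := by
    intro x hx
    rw [mem_Ici] at hx
    rcases le_or_gt x 1.501 with h | h
    · exact (monotoneOn_dawsonProduct ⟨hx, h⟩ ⟨by norm_num, le_rfl⟩ h).trans
        (hmax ⟨le_rfl, by norm_num⟩)
    rcases le_or_gt x 1.51 with h' | h'
    · exact hmax ⟨h.le, h'⟩
    · exact (antitoneOn_dawsonProduct (mem_Ici.2 le_rfl) h'.le h'.le).trans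
        (hmax ⟨by norm_num, le_rfl⟩)
  refine ⟨x₀, hpos, hglob, ?_⟩
  have hcrit : 2 * x₀ - 2 * (2 * x₀ ^ 2 - 1) * (Real.exp (-x₀ ^ 2) * expSqIntegral x₀) = 0 :=
    (hglob.isLocalMax (Ici_mem_nhds hpos)).hasDerivAt_eq_zero (hasDerivAt_dawsonProduct x₀)
  have hsq : 2.253 ≤ x₀ ^ 2 := by nlinarith [hx₀.1]
  have hval : dawsonProduct x₀ * (2 * x₀ ^ 2 - 1) = 2 * x₀ ^ 2 := by
    rw [dawsonProduct_eq]; linear_combination -x₀ * hcrit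
  have hup : dawsonProduct x₀ < 1.2855 := by
    by_contra h
    nlinarith
  have hlow : 1.2845 < dawsonProduct x₀ := by
    refine lt_of_lt_of_le ?_ (hglob (show (0 : ℝ) ≤ 1.5 by norm_num))
    rw [dawsonProduct_eq]
    have h1 : Real.exp (-1.5 ^ 2) * Real.exp (1.5 ^ 2) = 1 := by rw [← Real.exp_add]; simp
    have h2 := mul_le_mul_of_nonneg_left expSqIntegral_lower (Real.exp_pos (-1.5 ^ 2)).le
    rw [← mul_assoc, h1] at h2
    rw [mul_assoc]
    linarith
  rw [abs_lt]
  constructor <;> linarith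

/-! ### Desingularization by the scale s -/

/-- `e^{-s²(1-u²)}`. -/
noncomputable def gaussWeight (s u : ℝ) : ℝ := Real.exp (-(s ^ 2 * (1 - u ^ 2)))

/-- The density `(1+ρ)/(1+ρ-e^{-s²(1-u²)})`. -/
noncomputable def density (ρ s u : ℝ) : ℝ := (1 + ρ) / (1 + ρ - gaussWeight s u)

/-- The derivative of `density` with respect to `s²(u²-1)`. -/
noncomputable def densitySlope (ρ s u : ℝ) : ℝ :=
  (1 + ρ) * gaussWeight s u / (1 + ρ - gaussWeight s u) ^ 2

/-- `∫_0^1 u^k (1+ρ)/(1+ρ-e^{-s²(1-u²)}) du`. -/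
noncomputable def densityMoment (k : ℕ) (ρ s : ℝ) : ℝ := ∫ u in (0 : ℝ)..1, u ^ k * density ρ s u

/-- The value `a` with `1 + e^a = (1+ρ) e^{s²}`. -/
noncomputable def endpointOf (ρ s : ℝ) : ℝ := Real.log ((1 + ρ) * Real.exp (s ^ 2) - 1)

/-- The value `s ≥ 0` with `1 + e^a = (1+ρ) e^{s²}`. -/
noncomputable def scaleOf (ρ a : ℝ) : ℝ := √(gap a (Real.log ρ))

lemma continuous_gaussWeight (s : ℝ) : Continuous (gaussWeight s) := by
  unfold gaussWeight; fun_prop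

lemma gaussWeight_pos (s u : ℝ) : 0 < gaussWeight s u := Real.exp_pos _

lemma gaussWeight_le_one (s : ℝ) {u : ℝ} (hu : u ∈ Icc (0 : ℝ) 1) : gaussWeight s u ≤ 1 := by
  have : u ^ 2 ≤ 1 := pow_le_one₀ hu.1 hu.2
  exact Real.exp_le_one_iff.2 (by nlinarith [mul_nonneg (sq_nonneg s) (sub_nonneg.2 this)])

lemma le_sub_gaussWeight (ρ s : ℝ) {u : ℝ} (hu : u ∈ Icc (0 : ℝ) 1) :
    ρ ≤ 1 + ρ - gaussWeight s u := by linarith [gaussWeight_le_one s hu]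

lemma continuousOn_density {ρ : ℝ} (hρ : 0 < ρ) (s : ℝ) :
    ContinuousOn (density ρ s) (Icc 0 1) := by
  refine continuousOn_const.div (by have := continuous_gaussWeight s; fun_prop) fun u hu => ?_
  linarith [le_sub_gaussWeight ρ s hu]

lemma continuousOn_densitySlope {ρ : ℝ} (hρ : 0 < ρ) (s : ℝ) :
    ContinuousOn (densitySlope ρ s) (Icc 0 1) := by
  have := continuous_gaussWeight s
  refine ContinuousOn.div (by fun_prop) (by fun_prop) fun u hu => ?_
  have := le_sub_gaussWeight ρ s hu
  exact pow_ne_zero _ (by linarith)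

lemma one_le_density {ρ : ℝ} (hρ : 0 < ρ) (s : ℝ) {u : ℝ} (hu : u ∈ Icc (0 : ℝ) 1) :
    1 ≤ density ρ s u := by
  have h := le_sub_gaussWeight ρ s hu
  rw [density, le_div_iff₀ (by linarith)]
  linarith [gaussWeight_pos s u]

lemma density_le {ρ : ℝ} (hρ : 0 < ρ) (s : ℝ) {u : ℝ} (hu : u ∈ Icc (0 : ℝ) 1) :
    density ρ s u ≤ (1 + ρ) / ρ :=
  div_le_div_of_nonneg_left (by linarith) hρ (le_sub_gaussWeight ρ s hu)

lemma densitySlope_nonneg {ρ : ℝ} (hρ : 0 < ρ) (s u : ℝ) : 0 ≤ densitySlope ρ s u := by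
  have := gaussWeight_pos s u
  unfold densitySlope
  positivity

lemma densitySlope_le {ρ : ℝ} (hρ : 0 < ρ) (s : ℝ) {u : ℝ} (hu : u ∈ Icc (0 : ℝ) 1) :
    densitySlope ρ s u ≤ (1 + ρ) / ρ ^ 2 * gaussWeight s u := by
  have h := le_sub_gaussWeight ρ s hu
  have := gaussWeight_pos s u
  rw [densitySlope, div_mul_eq_mul_div]
  gcongr

lemma hasDerivAt_gaussWeight_right (s u : ℝ) :
    HasDerivAt (gaussWeight s) (2 * s ^ 2 * u * gaussWeight s u) u := by
  have h := (((hasDerivAt_pow 2 u).const_sub 1).const_mul (s ^ 2)).neg.exp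
  refine h.congr_deriv ?_
  simp [gaussWeight]
  ring

lemma hasDerivAt_gaussWeight_left (s u : ℝ) :
    HasDerivAt (fun s => gaussWeight s u) (-(2 * s * (1 - u ^ 2) * gaussWeight s u)) s := by
  have h := ((hasDerivAt_pow 2 s).mul_const (1 - u ^ 2)).neg.exp
  refine h.congr_deriv ?_
  simp [gaussWeight]
  ring

lemma hasDerivAt_density_right {ρ : ℝ} (hρ : 0 < ρ) (s : ℝ) {u : ℝ} (hu : u ∈ Icc (0 : ℝ) 1) :
    HasDerivAt (density ρ s) (2 * s ^ 2 * u * densitySlope ρ s u) u := by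
  have h0 := le_sub_gaussWeight ρ s hu
  have h := (hasDerivAt_const u (1 + ρ)).div
    ((hasDerivAt_gaussWeight_right s u).const_sub (1 + ρ)) (by linarith)
  refine h.congr_deriv ?_
  rw [densitySlope]
  ring

lemma hasDerivAt_density_left {ρ : ℝ} (hρ : 0 < ρ) (s : ℝ) {u : ℝ} (hu : u ∈ Icc (0 : ℝ) 1) :
    HasDerivAt (fun s => density ρ s u) (-(2 * s * (1 - u ^ 2) * densitySlope ρ s u)) s := by
  have h0 := le_sub_gaussWeight ρ s hu
  have h := (hasDerivAt_const s (1 + ρ)).div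
    ((hasDerivAt_gaussWeight_left s u).const_sub (1 + ρ)) (by linarith)
  refine h.congr_deriv ?_
  rw [densitySlope]
  ring

lemma intervalIntegrable_of_continuousOn_unit {f : ℝ → ℝ} (hf : ContinuousOn f (Icc 0 1)) :
    IntervalIntegrable f volume 0 1 :=
  ContinuousOn.intervalIntegrable (by rwa [uIcc_of_le zero_le_one])

lemma hasDerivAt_densityMoment (k : ℕ) {ρ : ℝ} (hρ : 0 < ρ) (s : ℝ) :
    HasDerivAt (densityMoment k ρ)
      (∫ u in (0 : ℝ)..1, u ^ k * -(2 * s * (1 - u ^ 2) * densitySlope ρ s u)) s := by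
  have hsub : ∀ u ∈ uIoc (0 : ℝ) 1, u ∈ Icc (0 : ℝ) 1 := fun u hu => by
    rw [uIoc_of_le zero_le_one] at hu; exact Ioc_subset_Icc_self hu
  have hc : ∀ x, ContinuousOn (fun u : ℝ => u ^ k * density ρ x u) (Icc 0 1) := fun x =>
    (by fun_prop : ContinuousOn (fun u : ℝ => u ^ k) _).mul (continuousOn_density hρ x)
  have hc' : ContinuousOn (fun u : ℝ => u ^ k * -(2 * s * (1 - u ^ 2) * densitySlope ρ s u))
      (Icc 0 1) := by
    have := continuousOn_densitySlope hρ s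
    fun_prop
  refine (intervalIntegral.hasDerivAt_integral_of_dominated_loc_of_deriv_le
    (F := fun x u => u ^ k * density ρ x u)
    (F' := fun x u => u ^ k * -(2 * x * (1 - u ^ 2) * densitySlope ρ x u))
    (bound := fun _ => 2 * (|s| + 1) * ((1 + ρ) / ρ ^ 2))
    (Metric.ball_mem_nhds s one_pos) (Eventually.of_forall fun x => ?_) ?_ ?_ ?_ ?_ ?_).2
  · exact (intervalIntegrable_iff.1
      (intervalIntegrable_of_continuousOn_unit (hc x))).aestronglyMeasurable
  · exact intervalIntegrable_of_continuousOn_unit (hc s)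
  · exact (intervalIntegrable_iff.1
      (intervalIntegrable_of_continuousOn_unit hc')).aestronglyMeasurable
  · refine Eventually.of_forall fun u hu x hx => ?_
    have hu' := hsub u hu
    have h1 : |u ^ k| ≤ 1 := by
      rw [abs_of_nonneg (pow_nonneg hu'.1 k)]; exact pow_le_one₀ hu'.1 hu'.2
    have h2 : |1 - u ^ 2| ≤ 1 := by
      have : u ^ 2 ≤ 1 := pow_le_one₀ hu'.1 hu'.2
      rw [abs_le]; constructor <;> nlinarith [sq_nonneg u]
    have h3 : |x| ≤ |s| + 1 := by
      have := abs_sub_abs_le_abs_sub x s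
      rw [Metric.mem_ball, Real.dist_eq] at hx
      linarith
    have h4 : |densitySlope ρ x u| ≤ (1 + ρ) / ρ ^ 2 := by
      rw [abs_of_nonneg (densitySlope_nonneg hρ x u)]
      refine (densitySlope_le hρ x hu').trans (mul_le_of_le_one_right (by positivity) ?_)
      exact gaussWeight_le_one x hu'
    rw [Real.norm_eq_abs, abs_mul, abs_neg, abs_mul, abs_mul, abs_mul, abs_two]
    calc |u ^ k| * (2 * |x| * |1 - u ^ 2| * |densitySlope ρ x u|)
        ≤ 1 * (2 * (|s| + 1) * 1 * ((1 + ρ) / ρ ^ 2)) := by gcongr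
      _ = _ := by ring
  · simp
  · exact Eventually.of_forall fun u hu x _ =>
      (hasDerivAt_density_left hρ x (hsub u hu)).const_mul _

/-- `slopeIntegral` in terms of the scale `s`. -/
noncomputable def scaledSlope (ρ s : ℝ) : ℝ := 2 * s * densityMoment 0 ρ s

/-- `∫ √(log ((1+e^a)/(1+e^x))) dx` in terms of the scale `s`. -/
noncomputable def scaledCost (ρ s : ℝ) : ℝ := 2 * s ^ 3 * densityMoment 2 ρ s

lemma density_one {ρ s : ℝ} : density ρ s 1 = (1 + ρ) / ρ := by
  simp [density, gaussWeight]

/-- The integral of the u-derivative of 2u · density is its boundary value at u = 1. Subtracting it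
removes the density itself and turns the weight 1 - u² into 1. -/
lemma hasDerivAt_scaledSlope {ρ : ℝ} (hρ : 0 < ρ) (s : ℝ) :
    HasDerivAt (scaledSlope ρ)
      (2 * ((1 + ρ) / ρ) - ∫ u in (0 : ℝ)..1, 4 * s ^ 2 * densitySlope ρ s u) s := by
  have h := ((hasDerivAt_id s).const_mul 2).mul (hasDerivAt_densityMoment 0 hρ s)
  refine h.congr_deriv ?_
  have hd := continuousOn_density hρ s
  have hq := continuousOn_densitySlope hρ s
  have e : ∫ u in (0 : ℝ)..1, (2 * density ρ s u + 2 * u * (2 * s ^ 2 * u * densitySlope ρ s u)) =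
      2 * 1 * density ρ s 1 - 2 * 0 * density ρ s 0 := by
    refine intervalIntegral.integral_eq_sub_of_hasDerivAt
      (f := fun u => 2 * u * density ρ s u) (fun u hu => ?_)
      (intervalIntegrable_of_continuousOn_unit (by fun_prop))
    rw [uIcc_of_le zero_le_one] at hu
    refine (((hasDerivAt_id u).const_mul 2).mul
      (hasDerivAt_density_right hρ s hu)).congr_deriv ?_
    simp
  have e2 : ∫ u in (0 : ℝ)..1,
      (2 * density ρ s u + 2 * u * (2 * s ^ 2 * u * densitySlope ρ s u)) =
      (∫ u in (0 : ℝ)..1, 2 * (u ^ 0 * density ρ s u)) +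
      (∫ u in (0 : ℝ)..1, 2 * s * (u ^ 0 * -(2 * s * (1 - u ^ 2) * densitySlope ρ s u))) +
      ∫ u in (0 : ℝ)..1, 4 * s ^ 2 * densitySlope ρ s u := by
    rw [← intervalIntegral.integral_add, ← intervalIntegral.integral_add]
    · exact intervalIntegral.integral_congr fun u _ => by ring
    all_goals exact intervalIntegrable_of_continuousOn_unit (by fun_prop)
  rw [intervalIntegral.integral_const_mul, intervalIntegral.integral_const_mul] at e2
  rw [e2, density_one] at e
  simp only [densityMoment, id]
  linarith

/-- An envelope identity: only the upper level of the gap contributes to the derivative of the cost.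
It follows by adding the u-derivative of 2s²(u³-u) · density, which vanishes at both ends. -/
lemma hasDerivAt_scaledCost {ρ : ℝ} (hρ : 0 < ρ) (s : ℝ) :
    HasDerivAt (scaledCost ρ) (s * scaledSlope ρ s) s := by
  have h := ((hasDerivAt_pow 3 s).const_mul 2).mul (hasDerivAt_densityMoment 2 hρ s)
  refine h.congr_deriv ?_
  have hd := continuousOn_density hρ s
  have hq := continuousOn_densitySlope hρ s
  have e : ∫ u in (0 : ℝ)..1, (2 * s ^ 2 * (3 * u ^ 2 - 1) * density ρ s u +
      2 * s ^ 2 * (u ^ 3 - u) * (2 * s ^ 2 * u * densitySlope ρ s u)) =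
      2 * s ^ 2 * (1 ^ 3 - 1) * density ρ s 1 - 2 * s ^ 2 * (0 ^ 3 - 0) * density ρ s 0 := by
    refine intervalIntegral.integral_eq_sub_of_hasDerivAt
      (f := fun u => 2 * s ^ 2 * (u ^ 3 - u) * density ρ s u) (fun u hu => ?_)
      (intervalIntegrable_of_continuousOn_unit (by fun_prop))
    rw [uIcc_of_le zero_le_one] at hu
    refine ((((hasDerivAt_pow 3 u).sub (hasDerivAt_id u)).const_mul (2 * s ^ 2)).mul
      (hasDerivAt_density_right hρ s hu)).congr_deriv ?_
    simp
  have e2 : ∫ u in (0 : ℝ)..1, (2 * s ^ 2 * (3 * u ^ 2 - 1) * density ρ s u +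
      2 * s ^ 2 * (u ^ 3 - u) * (2 * s ^ 2 * u * densitySlope ρ s u)) =
      (∫ u in (0 : ℝ)..1, 6 * s ^ 2 * (u ^ 2 * density ρ s u)) +
      (∫ u in (0 : ℝ)..1, 2 * s ^ 3 * (u ^ 2 * -(2 * s * (1 - u ^ 2) * densitySlope ρ s u))) -
      ∫ u in (0 : ℝ)..1, 2 * s ^ 2 * (u ^ 0 * density ρ s u) := by
    rw [← intervalIntegral.integral_add, ← intervalIntegral.integral_sub]
    · exact intervalIntegral.integral_congr fun u _ => by ring
    all_goals exact intervalIntegrable_of_continuousOn_unit (by fun_prop)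
  rw [intervalIntegral.integral_const_mul, intervalIntegral.integral_const_mul,
    intervalIntegral.integral_const_mul] at e2
  rw [e2] at e
  simp only [densityMoment, scaledSlope]
  push_cast
  linear_combination e

lemma mul_integral_gaussWeight (s : ℝ) :
    s * ∫ u in (0 : ℝ)..1, gaussWeight s u = Real.exp (-s ^ 2) * expSqIntegral s := by
  have h := intervalIntegral.mul_integral_comp_mul_left (a := 0) (b := 1)
    (f := fun t : ℝ => Real.exp (t ^ 2)) (c := s)
  rw [mul_zero, mul_one] at h
  rw [expSqIntegral, ← h, mul_left_comm,
    ← intervalIntegral.integral_const_mul (Real.exp (-s ^ 2))]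
  congr 1
  refine intervalIntegral.integral_congr fun u _ => ?_
  simp only [gaussWeight, ← Real.exp_add]
  congr 1
  ring

/-- Replacing the squared denominator by its minimum ρ² leaves a Gaussian integral, which is exactly
H(s) up to factors. This is where the threshold max H arises. -/
lemma scaledSlope_deriv_pos {ρ s : ℝ} (hρ : 0 < ρ) (hs : dawsonProduct s < ρ) :
    0 < 2 * ((1 + ρ) / ρ) - ∫ u in (0 : ℝ)..1, 4 * s ^ 2 * densitySlope ρ s u := by
  have hq := continuousOn_densitySlope hρ s
  have hg := continuous_gaussWeight s
  have h1 : ∫ u in (0 : ℝ)..1, 4 * s ^ 2 * densitySlope ρ s u ≤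
      ∫ u in (0 : ℝ)..1, 4 * s ^ 2 * ((1 + ρ) / ρ ^ 2) * gaussWeight s u := by
    refine intervalIntegral.integral_mono_on zero_le_one
      (intervalIntegrable_of_continuousOn_unit (by fun_prop))
      (intervalIntegrable_of_continuousOn_unit (by fun_prop)) fun u hu => ?_
    rw [mul_assoc (4 * s ^ 2)]
    exact mul_le_mul_of_nonneg_left (densitySlope_le hρ s hu) (by positivity)
  rw [intervalIntegral.integral_const_mul (4 * s ^ 2 * ((1 + ρ) / ρ ^ 2))] at h1
  have h2 : 4 * s ^ 2 * ((1 + ρ) / ρ ^ 2) * ∫ u in (0 : ℝ)..1, gaussWeight s u =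
      2 * ((1 + ρ) / ρ) * (dawsonProduct s / ρ) := by
    rw [dawsonProduct_eq, mul_assoc (2 * s), ← mul_integral_gaussWeight]
    field_simp
    ring
  have h3 : dawsonProduct s / ρ < 1 := (div_lt_one hρ).2 hs
  have h4 : 0 < 2 * ((1 + ρ) / ρ) := by positivity
  nlinarith

lemma strictMonoOn_scaledSlope {ρ : ℝ} (hρ : 0 < ρ) (h : ∀ s, 0 ≤ s → dawsonProduct s < ρ) :
    StrictMonoOn (scaledSlope ρ) (Ici 0) := by
  refine strictMonoOn_of_deriv_pos (convex_Ici 0)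
    (fun s _ => (hasDerivAt_scaledSlope hρ s).continuousAt.continuousWithinAt) fun s hs => ?_
  rw [interior_Ici] at hs
  rw [(hasDerivAt_scaledSlope hρ s).deriv]
  exact scaledSlope_deriv_pos hρ (h s (le_of_lt hs))

/-- The substitution `1 + e^x = (1+ρ) e^{s²(1-u²)}`. -/
noncomputable def pathValue (ρ s u : ℝ) : ℝ :=
  Real.log ((1 + ρ) * Real.exp (s ^ 2 * (1 - u ^ 2)) - 1)

lemma le_exp_sub_one {ρ t : ℝ} (hρ : 0 < ρ) (ht : 0 ≤ t) : ρ ≤ (1 + ρ) * Real.exp t - 1 := by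
  have := Real.one_le_exp ht
  nlinarith

lemma scale_exponent_nonneg (s : ℝ) {u : ℝ} (hu : u ∈ Icc (0 : ℝ) 1) :
    0 ≤ s ^ 2 * (1 - u ^ 2) := by
  have : u ^ 2 ≤ 1 := pow_le_one₀ hu.1 hu.2
  exact mul_nonneg (sq_nonneg s) (sub_nonneg.2 this)

lemma one_add_exp_endpointOf {ρ : ℝ} (hρ : 0 < ρ) (s : ℝ) :
    1 + Real.exp (endpointOf ρ s) = (1 + ρ) * Real.exp (s ^ 2) := by
  rw [endpointOf, Real.exp_log (hρ.trans_le (le_exp_sub_one hρ (sq_nonneg s)))]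
  ring

lemma gap_pathValue {ρ : ℝ} (hρ : 0 < ρ) (s : ℝ) {u : ℝ} (hu : u ∈ Icc (0 : ℝ) 1) :
    gap (endpointOf ρ s) (pathValue ρ s u) = s ^ 2 * u ^ 2 := by
  rw [gap, one_add_exp_endpointOf hρ, pathValue,
    Real.exp_log (hρ.trans_le (le_exp_sub_one hρ (scale_exponent_nonneg s hu))),
    add_sub_cancel, mul_div_mul_left _ _ (by positivity), ← Real.exp_sub, Real.log_exp]
  ring

lemma hasDerivAt_pathValue {ρ : ℝ} (hρ : 0 < ρ) (s : ℝ) {u : ℝ} (hu : u ∈ Icc (0 : ℝ) 1) :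
    HasDerivAt (pathValue ρ s) (-(2 * s ^ 2 * u * density ρ s u)) u := by
  have h0 := hρ.trans_le (le_exp_sub_one hρ (scale_exponent_nonneg s hu))
  have h := ((((((hasDerivAt_pow 2 u).const_sub 1).const_mul (s ^ 2)).exp).const_mul
    (1 + ρ)).sub_const 1).log h0.ne'
  refine h.congr_deriv ?_
  have h1 := hρ.trans_le (le_sub_gaussWeight ρ s hu)
  rw [density]
  rw [gaussWeight, Real.exp_neg] at h1 ⊢
  have h2 : (1 + ρ) / (1 + ρ - (Real.exp (s ^ 2 * (1 - u ^ 2)))⁻¹) =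
      (1 + ρ) * Real.exp (s ^ 2 * (1 - u ^ 2)) / ((1 + ρ) * Real.exp (s ^ 2 * (1 - u ^ 2)) - 1) := by
    rw [div_eq_div_iff h1.ne' h0.ne']
    field_simp
  rw [h2]
  push_cast
  ring

/-- The substitution is decreasing in u, hence valid for arbitrary G, in particular for the singular
1/√gap. -/
lemma integral_eq_integral_density {ρ : ℝ} (hρ : 0 < ρ) (s : ℝ) (G : ℝ → ℝ) :
    ∫ x in (Real.log ρ)..(endpointOf ρ s), G x =
      ∫ u in (0 : ℝ)..1, 2 * s ^ 2 * u * density ρ s u * G (pathValue ρ s u) := by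
  have h := integral_Icc_deriv_smul_of_deriv_nonpos (f := pathValue ρ s) (g := G)
    (f' := fun u => -(2 * s ^ 2 * u * density ρ s u)) (a := 0) (b := 1)
    (fun u hu => (hasDerivAt_pathValue hρ s hu).continuousAt.continuousWithinAt)
    (fun u hu => hasDerivAt_pathValue hρ s (Ioo_subset_Icc_self hu))
    (fun u hu => by
      have h1 := one_le_density hρ s (Ioo_subset_Icc_self hu)
      have h2 := hu.1
      have : 0 ≤ 2 * s ^ 2 * u * density ρ s u := by positivity
      linarith) zero_le_one
  have e0 : pathValue ρ s 0 = endpointOf ρ s := by simp [pathValue, endpointOf]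
  have e1 : pathValue ρ s 1 = Real.log ρ := by simp [pathValue]
  have hle : Real.log ρ ≤ endpointOf ρ s :=
    Real.log_le_log hρ (le_exp_sub_one hρ (sq_nonneg s))
  rw [e0, e1, integral_Icc_eq_integral_Ioc, integral_Icc_eq_integral_Ioc,
    ← intervalIntegral.integral_of_le zero_le_one, ← intervalIntegral.integral_of_le hle] at h
  rw [← neg_eq_iff_eq_neg, ← intervalIntegral.integral_neg] at h
  rw [← h]
  refine intervalIntegral.integral_congr fun u _ => ?_
  simp

lemma slopeIntegral_endpointOf {ρ s : ℝ} (hρ : 0 < ρ) (hs : 0 ≤ s) :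
    slopeIntegral (endpointOf ρ s) ρ = scaledSlope ρ s := by
  rw [slopeIntegral_eq, integral_eq_integral_density hρ, scaledSlope, densityMoment,
    ← intervalIntegral.integral_const_mul, intervalIntegral.integral_of_le zero_le_one,
    intervalIntegral.integral_of_le zero_le_one]
  refine setIntegral_congr_fun measurableSet_Ioc fun u hu => ?_
  have hu0 := hu.1
  rw [gap_pathValue hρ s (Ioc_subset_Icc_self hu), ← mul_pow, Real.sqrt_sq (by positivity)]
  rcases hs.eq_or_lt with rfl | hs
  · simp
  · field_simp

lemma integral_sqrt_gap_endpointOf {ρ s : ℝ} (hρ : 0 < ρ) (hs : 0 ≤ s) :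
    ∫ x in (Real.log ρ)..(endpointOf ρ s), √(gap (endpointOf ρ s) x) = scaledCost ρ s := by
  rw [integral_eq_integral_density hρ, scaledCost, densityMoment,
    ← intervalIntegral.integral_const_mul]
  refine intervalIntegral.integral_congr fun u hu => ?_
  rw [uIcc_of_le zero_le_one] at hu
  have hu0 := hu.1
  rw [gap_pathValue hρ s hu, ← mul_pow, Real.sqrt_sq (by positivity)]
  ring

/-! ### Existence and criticality of optimal endpoints -/

/-- `reducedFunctional` in terms of the scale `s`. -/
noncomputable def scaledFunctional (ρ β s : ℝ) : ℝ :=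
  Real.log (1 + ρ) + s ^ 2 - 1 / √β * scaledCost ρ s

lemma reducedFunctional_endpointOf {ρ s : ℝ} (β : ℝ) (hρ : 0 < ρ) (hs : 0 ≤ s) :
    reducedFunctional ρ β (endpointOf ρ s) = scaledFunctional ρ β s := by
  rw [reducedFunctional_eq, integral_sqrt_gap_endpointOf hρ hs, one_add_exp_endpointOf hρ,
    Real.log_mul (by positivity) (by positivity), Real.log_exp, scaledFunctional]

lemma log_le_endpointOf {ρ : ℝ} (hρ : 0 < ρ) (s : ℝ) : Real.log ρ ≤ endpointOf ρ s :=
  Real.log_le_log hρ (le_exp_sub_one hρ (sq_nonneg s))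

lemma scaleOf_nonneg (ρ a : ℝ) : 0 ≤ scaleOf ρ a := Real.sqrt_nonneg _

lemma endpointOf_scaleOf {ρ a : ℝ} (hρ : 0 < ρ) (ha : Real.log ρ ≤ a) :
    endpointOf ρ (scaleOf ρ a) = a := by
  rw [endpointOf, scaleOf, Real.sq_sqrt (gap_nonneg ha), gap, Real.exp_log (by positivity),
    Real.exp_log hρ, mul_div_cancel₀ _ (by positivity), add_sub_cancel_left, Real.log_exp]

lemma strictMonoOn_scaleOf {ρ : ℝ} : StrictMonoOn (scaleOf ρ) (Ici (Real.log ρ)) := by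
  intro a ha b _ hab
  refine Real.sqrt_lt_sqrt (gap_nonneg ha) ?_
  rw [gap_eq_sub, gap_eq_sub]
  have := Real.log_lt_log (by positivity) (add_lt_add_right (Real.exp_lt_exp.2 hab) 1)
  linarith

lemma strictMonoOn_slopeIntegral {ρ : ℝ} (hρ : 0 < ρ)
    (h : ∀ s, 0 ≤ s → dawsonProduct s < ρ) :
    StrictMonoOn (fun a => slopeIntegral a ρ) (Ici (Real.log ρ)) := by
  intro a ha b hb hab
  simp only
  rw [← endpointOf_scaleOf hρ ha, ← endpointOf_scaleOf hρ hb,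
    slopeIntegral_endpointOf hρ (scaleOf_nonneg _ _),
    slopeIntegral_endpointOf hρ (scaleOf_nonneg _ _)]
  exact strictMonoOn_scaledSlope hρ h (scaleOf_nonneg _ _) (scaleOf_nonneg _ _)
    (strictMonoOn_scaleOf ha hb hab)

lemma hasDerivAt_scaledFunctional {ρ : ℝ} (β : ℝ) (hρ : 0 < ρ) (s : ℝ) :
    HasDerivAt (scaledFunctional ρ β) (2 * s - 1 / √β * (s * scaledSlope ρ s)) s := by
  have h := ((hasDerivAt_pow 2 s).const_add (Real.log (1 + ρ))).sub
    ((hasDerivAt_scaledCost hρ s).const_mul (1 / √β))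
  refine h.congr_deriv ?_
  simp

lemma scaledCost_bounds {ρ s : ℝ} (hρ : 0 < ρ) (hs : 0 ≤ s) :
    2 / 3 * s ^ 3 ≤ scaledCost ρ s ∧ scaledCost ρ s ≤ 2 / 3 * s ^ 3 * ((1 + ρ) / ρ) := by
  have hd := continuousOn_density hρ s
  have h3 : ∀ c : ℝ, ∫ u in (0 : ℝ)..1, u ^ 2 * c = c / 3 := by
    intro c
    rw [intervalIntegral.integral_mul_const, integral_pow]
    norm_num
    ring
  have h1 : 1 / 3 ≤ densityMoment 2 ρ s := by
    rw [← h3, densityMoment]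
    refine intervalIntegral.integral_mono_on zero_le_one
      (intervalIntegrable_of_continuousOn_unit (by fun_prop))
      (intervalIntegrable_of_continuousOn_unit (by fun_prop)) fun u hu => ?_
    have := one_le_density hρ s hu
    gcongr
  have h2 : densityMoment 2 ρ s ≤ (1 + ρ) / ρ / 3 := by
    rw [← h3, densityMoment]
    refine intervalIntegral.integral_mono_on zero_le_one
      (intervalIntegrable_of_continuousOn_unit (by fun_prop))
      (intervalIntegrable_of_continuousOn_unit (by fun_prop)) fun u hu => ?_
    have := density_le hρ s hu
    gcongr
  have h4 : 0 ≤ 2 * s ^ 3 := by positivity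
  have h5 := mul_le_mul_of_nonneg_left h1 h4
  have h6 := mul_le_mul_of_nonneg_left h2 h4
  rw [scaledCost]
  constructor <;> linarith

lemma scaledFunctional_zero (ρ β : ℝ) : scaledFunctional ρ β 0 = Real.log (1 + ρ) := by
  simp [scaledFunctional, scaledCost]

lemma exists_scaledFunctional_gt {ρ β : ℝ} (hρ : 0 < ρ) (hβ : 0 < β) :
    ∃ s, 0 ≤ s ∧ Real.log (1 + ρ) < scaledFunctional ρ β s := by
  have hb : 0 < √β := Real.sqrt_pos.2 hβ
  -- At this s the upper bound on the cost, divided by √β, is (2/3)s², so the gain is at least s²/3.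
  refine ⟨ρ * √β / (1 + ρ), by positivity, ?_⟩
  set s := ρ * √β / (1 + ρ) with hs
  have hs0 : 0 < s := by positivity
  have h := mul_le_mul_of_nonneg_left (scaledCost_bounds hρ hs0.le).2
    (show 0 ≤ 1 / √β by positivity)
  have e : 1 / √β * (2 / 3 * s ^ 3 * ((1 + ρ) / ρ)) = 2 / 3 * s ^ 2 := by
    have : s * ((1 + ρ) / ρ) = √β := by rw [hs]; field_simp
    rw [show 1 / √β * (2 / 3 * s ^ 3 * ((1 + ρ) / ρ)) =
      1 / √β * (2 / 3 * s ^ 2 * (s * ((1 + ρ) / ρ))) by ring, this]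
    field_simp
  rw [scaledFunctional]
  nlinarith

/-- s = 0 is always critical, because of the factor s in the derivative, and has to be excluded by
comparing values. -/
lemma scaledSlope_eq_of_isMaxOn {ρ β s : ℝ} (hρ : 0 < ρ) (hβ : 0 < β) (hs : 0 ≤ s)
    (hmax : IsMaxOn (scaledFunctional ρ β) (Ici 0) s) : 0 < s ∧ scaledSlope ρ s = 2 * √β := by
  have hb : 0 < √β := Real.sqrt_pos.2 hβ
  have hs0 : 0 < s := by
    refine hs.lt_of_ne fun h => ?_
    obtain ⟨r, hr, hlt⟩ := exists_scaledFunctional_gt hρ hβ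
    have : scaledFunctional ρ β r ≤ scaledFunctional ρ β s := hmax hr
    rw [← h, scaledFunctional_zero] at this
    linarith
  refine ⟨hs0, ?_⟩
  have h := (hmax.isLocalMax (Ici_mem_nhds hs0)).hasDerivAt_eq_zero
    (hasDerivAt_scaledFunctional β hρ s)
  have : s * (2 * √β - scaledSlope ρ s) = 0 := by
    field_simp at h
    linear_combination h
  rcases mul_eq_zero.1 this with h | h
  · exact absurd h hs0.ne'
  · linarith

lemma isOptimalEndpoint_iff {ρ β a : ℝ} (hρ : 0 < ρ) (ha : Real.log ρ ≤ a) :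
    IsOptimalEndpoint ρ β a ↔ IsMaxOn (scaledFunctional ρ β) (Ici 0) (scaleOf ρ a) := by
  have key : ∀ b, Real.log ρ ≤ b →
      reducedFunctional ρ β b = scaledFunctional ρ β (scaleOf ρ b) := fun b hb => by
    rw [← reducedFunctional_endpointOf β hρ (scaleOf_nonneg _ _), endpointOf_scaleOf hρ hb]
  constructor
  · intro h s hs
    have := h.2 (log_le_endpointOf hρ s)
    simp only [mem_ofPred_eq] at this ⊢
    rwa [key a ha, reducedFunctional_endpointOf β hρ hs] at this
  · refine fun h => ⟨ha, fun b hb => ?_⟩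
    simp only [mem_ofPred_eq]
    rw [key a ha, key b hb]
    exact h (scaleOf_nonneg _ _)

lemma slopeIntegral_of_isOptimalEndpoint {ρ β a : ℝ} (hρ : 0 < ρ) (hβ : 0 < β)
    (h : IsOptimalEndpoint ρ β a) : slopeIntegral a ρ = 2 * √β := by
  rw [← endpointOf_scaleOf hρ h.1, slopeIntegral_endpointOf hρ (scaleOf_nonneg _ _)]
  exact (scaledSlope_eq_of_isMaxOn hρ hβ (scaleOf_nonneg _ _)
    ((isOptimalEndpoint_iff hρ h.1).1 h)).2

lemma scaleOf_endpointOf {ρ s : ℝ} (hρ : 0 < ρ) (hs : 0 ≤ s) :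
    scaleOf ρ (endpointOf ρ s) = s := by
  rw [scaleOf, gap, one_add_exp_endpointOf hρ, Real.exp_log hρ, mul_div_cancel_left₀ _
    (by positivity), Real.log_exp, Real.sqrt_sq hs]

lemma exists_isOptimalEndpoint {ρ β : ℝ} (hρ : 0 < ρ) (hβ : 0 < β) :
    ∃ a, IsOptimalEndpoint ρ β a := by
  have hb : 0 < √β := Real.sqrt_pos.2 hβ
  have hcont : Continuous (scaledFunctional ρ β) :=
    continuous_iff_continuousAt.2 fun s => (hasDerivAt_scaledFunctional β hρ s).continuousAt
  -- Beyond (3/2)√β the bound cost ≥ (2/3)s³ outweighs s², so the functional is below its value at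
  -- 0.
  obtain ⟨s, hs, hmax⟩ := (isCompact_Icc (a := (0 : ℝ)) (b := 3 / 2 * √β)).exists_isMaxOn
    ⟨0, le_rfl, by positivity⟩ hcont.continuousOn
  refine ⟨endpointOf ρ s, (isOptimalEndpoint_iff hρ (log_le_endpointOf hρ s)).2 ?_⟩
  rw [scaleOf_endpointOf hρ hs.1]
  intro r hr
  rcases le_or_gt r (3 / 2 * √β) with h | h
  · exact hmax ⟨hr, h⟩
  · have h0 : scaledFunctional ρ β 0 ≤ scaledFunctional ρ β s :=
      hmax (show (0 : ℝ) ∈ Icc 0 (3 / 2 * √β) from ⟨le_rfl, by positivity⟩)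
    refine le_trans ?_ h0
    have hr0 : 0 < r := lt_trans (by positivity) h
    have h1 := mul_le_mul_of_nonneg_left (scaledCost_bounds hρ hr0.le).1
      (show 0 ≤ 1 / √β by positivity)
    have h2 : r ^ 2 ≤ 1 / √β * (2 / 3 * r ^ 3) := by
      rw [one_div_mul_eq_div, le_div_iff₀ hb]
      nlinarith [mul_pos hr0 hr0]
    rw [scaledFunctional_zero, scaledFunctional]
    linarith

/-- The Lyapunov exponent. -/
noncomputable def lyapunovExponent (p : ℝ × ℝ) : ℝ :=
  sSup (reducedFunctional p.1 p.2 '' Ici (Real.log p.1))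

lemma lyapunovExponent_eq {ρ β a : ℝ} (h : IsOptimalEndpoint ρ β a) :
    lyapunovExponent (ρ, β) = reducedFunctional ρ β a :=
  IsGreatest.csSup_eq ⟨mem_image_of_mem _ h.1, by rintro _ ⟨b, hb, rfl⟩; exact h.2 hb⟩

lemma lyapunovExponent_eq_scaledFunctional {ρ β s : ℝ} (hρ : 0 < ρ) (hβ : 0 < β)
    (h : ∀ s, 0 ≤ s → dawsonProduct s < ρ) (hs : 0 ≤ s) (hF : scaledSlope ρ s = 2 * √β) :
    lyapunovExponent (ρ, β) = scaledFunctional ρ β s := by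
  obtain ⟨a, ha⟩ := exists_isOptimalEndpoint hρ hβ
  have h1 := slopeIntegral_of_isOptimalEndpoint hρ hβ ha
  have h2 : a = endpointOf ρ s := by
    refine (strictMonoOn_slopeIntegral hρ h).injOn ha.1 (log_le_endpointOf hρ s) ?_
    rw [h1, slopeIntegral_endpointOf hρ hs, hF]
  rw [lyapunovExponent_eq ha, h2, reducedFunctional_endpointOf β hρ hs]

/-! ### Joint analyticity -/

/-- The functional `f ↦ ∫_0^1 u^k f(u) du` on continuous functions. -/
noncomputable def momentCLM (k : ℕ) : C(Icc (0 : ℝ) 1, ℝ) →L[ℝ] ℝ :=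
  LinearMap.mkContinuous
    { toFun := fun f => ∫ u in (0 : ℝ)..1, u ^ k * IccExtend zero_le_one f u
      map_add' := fun f g => by
        have hf : Continuous (IccExtend zero_le_one f) := f.continuous.Icc_extend'
        have hg : Continuous (IccExtend zero_le_one g) := g.continuous.Icc_extend'
        rw [← intervalIntegral.integral_add ((by fun_prop : Continuous _).intervalIntegrable _ _)
          ((by fun_prop : Continuous _).intervalIntegrable _ _)]
        exact intervalIntegral.integral_congr fun u _ => by simp [IccExtend]; ring
      map_smul' := fun c f => by
        simp only [RingHom.id_apply, smul_eq_mul]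
        rw [← intervalIntegral.integral_const_mul]
        exact intervalIntegral.integral_congr fun u _ => by simp [IccExtend]; ring }
    1 fun f => by
      have h := intervalIntegral.norm_integral_le_of_norm_le_const (a := (0 : ℝ)) (b := 1)
        (f := fun u => u ^ k * IccExtend zero_le_one f u) (C := ‖f‖) fun u hu => by
          rw [uIoc_of_le zero_le_one] at hu
          rw [norm_mul, Real.norm_of_nonneg (pow_nonneg hu.1.le k)]
          calc u ^ k * ‖IccExtend zero_le_one f u‖ ≤ 1 * ‖f‖ := by
                gcongr
                · exact pow_le_one₀ hu.1.le hu.2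
                · exact f.norm_coe_le_norm _
            _ = ‖f‖ := one_mul _
      simpa using h

lemma momentCLM_apply (k : ℕ) (f : C(Icc (0 : ℝ) 1, ℝ)) :
    momentCLM k f = ∫ u in (0 : ℝ)..1, u ^ k * IccExtend zero_le_one f u := rfl

/-- The function `u ↦ 1 - u²` on the unit interval. -/
def oneSubSq : C(Icc (0 : ℝ) 1, ℝ) := ⟨fun u => 1 - (u : ℝ) ^ 2, by fun_prop⟩

lemma oneSubSq_apply (u : Icc (0 : ℝ) 1) : oneSubSq u = 1 - (u : ℝ) ^ 2 := rfl

/-- The function `u ↦ 1 + ρ - e^{-s²(1-u²)}`, as an element of a Banach algebra. -/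
noncomputable def densityDenom (p : ℝ × ℝ) : C(Icc (0 : ℝ) 1, ℝ) :=
  (1 + p.1) • 1 - NormedSpace.exp (-(p.2 ^ 2) • oneSubSq)

lemma densityDenom_apply (p : ℝ × ℝ) (u : Icc (0 : ℝ) 1) :
    densityDenom p u = 1 + p.1 - gaussWeight p.2 u := by
  have h := NormedSpace.map_exp (ContinuousMap.evalAlgHom ℝ ℝ u)
    (continuous_eval_const u) (-(p.2 ^ 2) • oneSubSq)
  simp only [ContinuousMap.evalAlgHom_apply] at h
  rw [densityDenom, ContinuousMap.sub_apply, h, ← Real.exp_eq_exp_ℝ]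
  simp [gaussWeight, oneSubSq_apply]

lemma analyticAt_densityDenom (p : ℝ × ℝ) : AnalyticAt ℝ densityDenom p := by
  have h : AnalyticAt ℝ (fun p : ℝ × ℝ => -(p.2 ^ 2) • oneSubSq) p :=
    ((analyticAt_snd.pow 2).neg).smul analyticAt_const
  exact ((analyticAt_const.add analyticAt_fst).smul analyticAt_const).sub
    ((NormedSpace.exp_analytic (𝕂 := ℝ) _).fun_comp h)

lemma isUnit_densityDenom {p : ℝ × ℝ} (hp : 0 < p.1) : IsUnit (densityDenom p) := by
  rw [ContinuousMap.isUnit_iff_forall_ne_zero]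
  intro u
  rw [densityDenom_apply]
  exact (hp.trans_le (le_sub_gaussWeight p.1 p.2 u.2)).ne'

lemma densityMoment_eq_momentCLM (k : ℕ) {p : ℝ × ℝ} (hp : 0 < p.1) :
    densityMoment k p.1 p.2 = momentCLM k ((1 + p.1) • Ring.inverse (densityDenom p)) := by
  rw [momentCLM_apply, densityMoment]
  refine intervalIntegral.integral_congr fun u hu => ?_
  rw [uIcc_of_le zero_le_one] at hu
  rw [IccExtend_of_mem _ _ hu]
  congr 1
  have h := congrArg (fun f : C(Icc (0 : ℝ) 1, ℝ) => f ⟨u, hu⟩)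
    (Ring.inverse_mul_cancel _ (isUnit_densityDenom hp))
  simp only [ContinuousMap.mul_apply, densityDenom_apply, ContinuousMap.one_apply] at h
  rw [ContinuousMap.smul_apply, smul_eq_mul, density, div_eq_mul_inv, eq_inv_of_mul_eq_one_left h]

/-- The denominator depends analytically on (ρ, s) as an element of the Banach algebra C([0,1]),
inversion is analytic at units, and the moment is continuous linear. No power series has to be
exchanged with the integral. -/
lemma analyticAt_densityMoment (k : ℕ) {p : ℝ × ℝ} (hp : 0 < p.1) :
    AnalyticAt ℝ (fun p : ℝ × ℝ => densityMoment k p.1 p.2) p := by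
  obtain ⟨x, hx⟩ := isUnit_densityDenom hp
  have hinv : AnalyticAt ℝ (fun p => Ring.inverse (densityDenom p)) p := by
    have h := analyticAt_inverse (𝕜 := ℝ) x
    rw [hx] at h
    exact h.fun_comp (analyticAt_densityDenom p)
  have h := ((momentCLM k).analyticAt _).fun_comp
    ((analyticAt_const (v := (1 : ℝ)).add analyticAt_fst).smul hinv)
  refine h.congr ?_
  filter_upwards [continuousAt_fst.eventually (lt_mem_nhds hp)] with q hq
  exact (densityMoment_eq_momentCLM k hq).symm

lemma analyticAt_scaledSlope {p : ℝ × ℝ} (hp : 0 < p.1) :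
    AnalyticAt ℝ (fun p : ℝ × ℝ => scaledSlope p.1 p.2) p :=
  (analyticAt_const.mul analyticAt_snd).mul (analyticAt_densityMoment 0 hp)

lemma analyticAt_scaledCost {p : ℝ × ℝ} (hp : 0 < p.1) :
    AnalyticAt ℝ (fun p : ℝ × ℝ => scaledCost p.1 p.2) p :=
  (analyticAt_const.mul (analyticAt_snd.pow 3)).mul (analyticAt_densityMoment 2 hp)

lemma analyticAt_sqrt {x : ℝ} (hx : 0 < x) : AnalyticAt ℝ (fun x : ℝ => √x) x :=
  (Real.contDiffAt_sqrt hx.ne').analyticAt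

/-- The implicit function theorem solves F = 2√β for s near (ρ₀, β₀). The condition on H is needed
for all nearby ρ, so that the local solution is the global maximizer there. -/
lemma analyticAt_lyapunovExponent {ρ₀ β₀ : ℝ} (hρ₀ : 0 < ρ₀) (hβ₀ : 0 < β₀)
    (h : ∀ᶠ ρ in 𝓝 ρ₀, ∀ s, 0 ≤ s → dawsonProduct s < ρ) :
    AnalyticAt ℝ lyapunovExponent (ρ₀, β₀) := by
  obtain ⟨a₀, ha₀⟩ := exists_isOptimalEndpoint hρ₀ hβ₀
  set s₀ := scaleOf ρ₀ a₀
  obtain ⟨hs₀, hF₀⟩ := scaledSlope_eq_of_isMaxOn hρ₀ hβ₀ (scaleOf_nonneg ρ₀ a₀)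
    ((isOptimalEndpoint_iff hρ₀ ha₀.1).1 ha₀)
  let f : (ℝ × ℝ) × ℝ → ℝ := fun q => scaledSlope q.1.1 q.2 - 2 * √q.1.2
  let u : (ℝ × ℝ) × ℝ := ((ρ₀, β₀), s₀)
  have hfu : f u = 0 := by simp only [f, u]; linarith
  have hf : AnalyticAt ℝ f u := by
    have h1 : AnalyticAt ℝ (fun q : (ℝ × ℝ) × ℝ => scaledSlope q.1.1 q.2) u :=
      AnalyticAt.comp₂ (h := fun p : ℝ × ℝ => scaledSlope p.1 p.2)
        (analyticAt_scaledSlope (p := (ρ₀, s₀)) hρ₀)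
        (analyticAt_fst.fun_comp analyticAt_fst) analyticAt_snd
    have h2 : AnalyticAt ℝ (fun q : (ℝ × ℝ) × ℝ => √q.1.2) u :=
      (analyticAt_sqrt hβ₀).fun_comp (f := fun q : (ℝ × ℝ) × ℝ => q.1.2)
        (analyticAt_snd.fun_comp analyticAt_fst)
    exact h1.sub (analyticAt_const.mul h2)
  -- The smoothness index `⊤` means analyticity, so the implicit function is analytic.
  have hcd : ContDiffAt ℝ ⊤ f u := hf.contDiffAt
  have hinv : (fderiv ℝ f u ∘L .inr ℝ (ℝ × ℝ) ℝ).IsInvertible := by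
    have hpos := scaledSlope_deriv_pos hρ₀ (h.self_of_nhds s₀ hs₀.le)
    have hd := (hasDerivAt_scaledSlope hρ₀ s₀).sub_const (2 * √β₀)
    have hd' : HasDerivAt (fun s => f ((ρ₀, β₀), s))
        ((fderiv ℝ f u ∘L .inr ℝ (ℝ × ℝ) ℝ) 1) s₀ := by
      have := (hasFDerivAt_prodMk_right (𝕜 := ℝ) (ρ₀, β₀) s₀)
      exact (hf.differentiableAt.hasFDerivAt.comp s₀ this).hasDerivAt
    have hne : (fderiv ℝ f u ∘L .inr ℝ (ℝ × ℝ) ℝ) 1 ≠ 0 := by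
      rw [hd'.unique hd]; exact hpos.ne'
    refine ⟨ContinuousLinearEquiv.unitsEquivAut ℝ (Units.mk0 _ hne), ?_⟩
    ext
    simp
  let ψ := hcd.implicitFunction (by simp) hinv
  have hψ : AnalyticAt ℝ ψ (ρ₀, β₀) :=
    (hcd.contDiffAt_implicitFunction (by simp) hinv).analyticAt
  have hψ₀ : ψ (ρ₀, β₀) = s₀ := hcd.implicitFunction_apply_self (by simp) hinv
  have hψeq : ∀ᶠ p in 𝓝 (ρ₀, β₀), f (p, ψ p) = f u :=
    hcd.eventually_apply_implicitFunction (by simp) hinv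
  have hψpos : ∀ᶠ p in 𝓝 (ρ₀, β₀), 0 < ψ p :=
    hψ.continuousAt.eventually (lt_mem_nhds (hψ₀ ▸ hs₀))
  have hρ : ∀ᶠ p : ℝ × ℝ in 𝓝 (ρ₀, β₀), 0 < p.1 :=
    continuousAt_fst.eventually (lt_mem_nhds hρ₀)
  have hβ : ∀ᶠ p : ℝ × ℝ in 𝓝 (ρ₀, β₀), 0 < p.2 :=
    continuousAt_snd.eventually (lt_mem_nhds hβ₀)
  have hρ' : ∀ᶠ p : ℝ × ℝ in 𝓝 (ρ₀, β₀), ∀ s, 0 ≤ s → dawsonProduct s < p.1 :=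
    (continuous_fst.tendsto (ρ₀, β₀)).eventually h
  have hmain : AnalyticAt ℝ (fun p : ℝ × ℝ => scaledFunctional p.1 p.2 (ψ p)) (ρ₀, β₀) := by
    have h1 : AnalyticAt ℝ (fun p : ℝ × ℝ => Real.log (1 + p.1)) (ρ₀, β₀) :=
      ((Real.contDiffAt_log (n := ⊤)).2 (show (1 : ℝ) + ρ₀ ≠ 0 by positivity)).analyticAt.fun_comp
        (f := fun p : ℝ × ℝ => 1 + p.1) (analyticAt_const.add analyticAt_fst)
    have h2 : AnalyticAt ℝ (fun p : ℝ × ℝ => 1 / √p.2) (ρ₀, β₀) :=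
      analyticAt_const.div ((analyticAt_sqrt hβ₀).fun_comp (f := fun p : ℝ × ℝ => p.2)
        analyticAt_snd) (Real.sqrt_pos.2 hβ₀).ne'
    have h3 : AnalyticAt ℝ (fun p : ℝ × ℝ => scaledCost p.1 (ψ p)) (ρ₀, β₀) :=
      AnalyticAt.comp₂ (h := fun p : ℝ × ℝ => scaledCost p.1 p.2)
        (analyticAt_scaledCost (p := (ρ₀, ψ (ρ₀, β₀))) hρ₀) analyticAt_fst hψ
    exact (h1.add (hψ.pow 2)).sub (h2.mul h3)
  refine hmain.congr ?_
  filter_upwards [hψeq, hψpos, hρ, hβ, hρ'] with p h1 h2 h3 h4 h5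
  rw [hfu] at h1
  exact (lyapunovExponent_eq_scaledFunctional h3 h4 h5 h2.le (sub_eq_zero.1 h1)).symm

/-! ### Absence of phase transitions -/

lemma analyticOnNhd_iterPartial {f : ℝ × ℝ → ℝ} {U : Set (ℝ × ℝ)} (hU : IsOpen U)
    (hUP : U ⊆ paramSpace) (hf : AnalyticOnNhd ℝ f U) (w : List (Fin 2)) :
    AnalyticOnNhd ℝ (iterPartial f w) U ∧ U ⊆ iterPartialDomain f w := by
  induction w with
  | nil => exact ⟨hf, hUP⟩
  | cons i w ih =>
    constructor
    · intro p hp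
      have h : AnalyticAt ℝ (fun q => fderiv ℝ (iterPartial f w) q (coordDir i)) p :=
        (ContinuousLinearMap.apply ℝ ℝ (coordDir i)).analyticAt _ |>.fun_comp (ih.1 p hp).fderiv
      refine h.congr ?_
      filter_upwards [hU.mem_nhds hp] with q hq
      exact (ih.1 q hq).differentiableAt.lineDeriv_eq_fderiv.symm
    · intro p hp
      refine ⟨?_, (ih.1 p hp).differentiableAt.lineDifferentiableAt⟩
      have hc : Continuous fun t : ℝ => p + t • coordDir i := by fun_prop
      have h0 : U ∈ 𝓝 (p + (0 : ℝ) • coordDir i) := by simpa using hU.mem_nhds hp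
      filter_upwards [hc.continuousAt.eventually_mem h0] with t ht
      exact ih.2 ht

/-- All iterated partial derivatives exist and are continuous on U, so no order can supply the
required discontinuity, whatever the phases are. -/
lemma not_isPhaseTransition_of_analyticOnNhd {f : ℝ × ℝ → ℝ} {U : Set (ℝ × ℝ)} (hU : IsOpen U)
    (hUP : U ⊆ paramSpace) (hf : AnalyticOnNhd ℝ f U) (j : ℕ) {p : ℝ × ℝ} (hp : p ∈ U) :
    ¬ IsPhaseTransition f j p := by
  rintro ⟨-, -, ⟨w, -, hw⟩, -⟩
  obtain ⟨h1, h2⟩ := analyticOnNhd_iterPartial hU hUP hf w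
  exact hw ⟨h2 hp, (h1 p hp).continuousAt.continuousWithinAt⟩

end RandomGrowth

theorem mainTheorem5 {Ω : Type*} [MeasurableSpace Ω] (P : Measure Ω) (W : ℝ≥0 → Ω → ℝ)
    (hW : IsBrownianReal W P) :
    ∃ (x₀ : ℝ) (lam : ℝ × ℝ → ℝ),
      -- the constant `H(x₀) = max H`
      0 < x₀ ∧ IsMaxOn RandomGrowth.dawsonProduct (Ici 0) x₀ ∧
      |RandomGrowth.dawsonProduct x₀ - 1.285| < 0.0005 ∧
      -- `lam` is the Lyapunov exponent
      (∀ ρ β : ℝ, 0 < ρ → 0 < β →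
        RandomGrowth.HasLyapunovExponent W P ρ β (lam (ρ, β))) ∧
      -- `F(· ; ρ)` is strictly increasing
      (∀ ρ : ℝ, RandomGrowth.dawsonProduct x₀ < ρ →
        StrictMonoOn (fun a => RandomGrowth.slopeIntegral a ρ) (Ici (Real.log ρ))) ∧
      -- the optimal `h(1)` is unique, it solves `F(a; ρ) = 2 √β`, and it gives the exponent
      (∀ ρ β : ℝ, RandomGrowth.dawsonProduct x₀ < ρ → 0 < β →
        (∃! a : ℝ, RandomGrowth.IsOptimalEndpoint ρ β a) ∧
        ∀ a : ℝ, RandomGrowth.IsOptimalEndpoint ρ β a →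
          RandomGrowth.slopeIntegral a ρ = 2 * √β ∧
          lam (ρ, β) = RandomGrowth.reducedFunctional ρ β a) ∧
      -- the Lyapunov exponent is analytic, jointly in `(ρ, β)`
      AnalyticOnNhd ℝ lam {p : ℝ × ℝ | RandomGrowth.dawsonProduct x₀ < p.1 ∧ 0 < p.2} ∧
      -- there are no phase transitions
      ∀ (j : ℕ) (p : ℝ × ℝ), RandomGrowth.dawsonProduct x₀ < p.1 →
        ¬ RandomGrowth.IsPhaseTransition lam j p := by
  obtain ⟨x₀, hx₀, hmax, hval⟩ := RandomGrowth.exists_isMaxOn_dawsonProduct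
  have hpos : 0 < RandomGrowth.dawsonProduct x₀ := by
    have := (abs_lt.1 hval).1
    linarith
  have hlt : ∀ ρ, RandomGrowth.dawsonProduct x₀ < ρ →
      ∀ s, 0 ≤ s → RandomGrowth.dawsonProduct s < ρ := fun ρ hρ s hs => (hmax hs).trans_lt hρ
  have hmono : ∀ ρ : ℝ, RandomGrowth.dawsonProduct x₀ < ρ →
      StrictMonoOn (fun a => RandomGrowth.slopeIntegral a ρ) (Ici (Real.log ρ)) := fun ρ hρ =>
    RandomGrowth.strictMonoOn_slopeIntegral (hpos.trans hρ) (hlt ρ hρ)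
  have hana : AnalyticOnNhd ℝ RandomGrowth.lyapunovExponent
      {p : ℝ × ℝ | RandomGrowth.dawsonProduct x₀ < p.1 ∧ 0 < p.2} := fun p hp =>
    RandomGrowth.analyticAt_lyapunovExponent (hpos.trans hp.1) hp.2
      ((lt_mem_nhds hp.1).mono hlt)
  refine ⟨x₀, RandomGrowth.lyapunovExponent, hx₀, hmax, hval, ?_, hmono, ?_, hana, ?_⟩
  · intro ρ β hρ hβ
    -- The limit needs only some maximizer, not uniqueness, so no lower bound on ρ beyond positivity
    -- enters.
    obtain ⟨a, ha⟩ := RandomGrowth.exists_isOptimalEndpoint hρ hβ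
    rw [RandomGrowth.lyapunovExponent_eq ha]
    exact RandomGrowth.hasLyapunovExponent_reducedFunctional hW.toIsPreBrownianReal hρ hβ ha
      (RandomGrowth.slopeIntegral_of_isOptimalEndpoint hρ hβ ha)
  · intro ρ β hρ hβ
    have hF := fun a => RandomGrowth.slopeIntegral_of_isOptimalEndpoint (a := a)
      (hpos.trans hρ) hβ
    refine ⟨?_, fun a ha => ⟨hF a ha, RandomGrowth.lyapunovExponent_eq ha⟩⟩
    obtain ⟨a, ha⟩ := RandomGrowth.exists_isOptimalEndpoint (hpos.trans hρ) hβ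
    exact ⟨a, ha, fun b hb => (hmono ρ hρ).injOn hb.1 ha.1 ((hF b hb).trans (hF a ha).symm)⟩
  · intro j p hp hpt
    refine RandomGrowth.not_isPhaseTransition_of_analyticOnNhd
      ((isOpen_lt continuous_const continuous_fst).inter (isOpen_lt continuous_const continuous_snd))
      (fun q hq => ⟨hpos.trans hq.1, hq.2⟩) hana j ⟨hp, hpt.1.2⟩ hpt
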